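/- Let $G$ be a connected and simply connected Lie group whose $n$-dimensional Lie algebra $\mathfrak g$ is semisimple and unimodular, with Killing form $k$, and let $\pi : P \to M$ be a smooth principal $G$-bundle with right action $R_g$. For $\xi\in\mathfrak g$ let $\xi^P$ be its fundamental vector field on $P$. Notation. $\Gamma_G(TP)$ denotes the $C^\infty(M)$-module of $R_g$-invariant vector fields on $P$ (the Atiyah Lie algebroid) and $\Gamma_G(P,\mathfrak g)$ the module of smooth maps $v:P\to\mathfrak g$ with $v(p\cdot g)=\mathrm{Ad}_{g^{-1}}v(p)$, included in $\Gamma_G(TP)$ by $\iota(v)(p)=-v(p)^P_{|p}$. $\Omega^q_{\mathrm{Lie}}(P,\mathfrak g)$ (resp. $\Omega^q_{\mathrm{Lie}}(P)$) is the space of alternating $C^\infty(M)$-multilinear maps $\Gamma_G(TP)^q\to\Gamma_G(P,\mathfrak g)$ (resp. $\to C^\infty(M)$). For a manifold $N$, $\mathrm{TLA}(N,\mathfrak g)$ is the space of pairs $X\oplus\gamma$ of a vector field and a smooth map $N\to\mathfrak g$, with bracket $[X\oplus\gamma,Y\oplus\eta]=[X,Y]\oplus(X\cdot\eta-Y\cdot\gamma+[\gamma,\eta])$;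 $\Omega_{\mathrm{TLA}}(N,\mathfrak g)=\Omega(N)\otimes\bigwedge\mathfrak g^*\otimes\mathfrak g$ and $\Omega_{\mathrm{TLA}}(N)=\Omega(N)\otimes\bigwedge\mathfrak g^*$ are its spaces of forms. Put $\mathfrak g_{\mathrm{equ}}=\{\xi^P\oplus\xi : \xi\in\mathfrak g\}\subset \mathrm{TLA}(P,\mathfrak g)$; a form on $\mathrm{TLA}(P,\mathfrak g)$ is $\mathfrak g_{\mathrm{equ}}$-basic if its inner product with, and its Lie derivative along, every element of $\mathfrak g_{\mathrm{equ}}$ vanish. A basic form $\widehat\omega$ corresponds to a form $\omega$ on $\Gamma_G(TP)$ if $\omega(\mathsf X_1,\dots,\mathsf X_q)(p)=\widehat\omega(\widehat X_1,\dots,\widehat X_q)(p)$ for all $\mathsf X_k\in\Gamma_G(TP)$, all $p\in P$ and all $\widehat X_k=(\mathsf X_k+v_k^P)\oplus v_k$ with $v_k:P\to\mathfrak g$ smooth, where $v_k^P(p)=v_k(p)^P_{|p}$. Let $\varphi_i:P_{|U_i}\to U_i\times G$ be a local trivialization of $P$, with section $s_i(x)=\varphi_i^{-1}(x,e)$. For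 $p=s_i(x)\cdot g$ put $\nabla^{0,i}_{X|p}=TR_g\,Ts_i\,X_{|x}$, $\Psi_i(\gamma)(p)=\mathrm{Ad}_{g^{-1}}\gamma(x)$ and $S_i(X\oplus\gamma)=\nabla^{0,i}_X+\iota(\Psi_i(\gamma))$. The local trivialization of a $\Gamma_G(P,\mathfrak g)$-valued form $\omega$ is $\omega^i_{\mathrm{loc}}=\Psi_i^{-1}\circ\omega\circ S_i$ (with $\Psi_i^{-1}(v)=s_i^*v$), and similarly, evaluating on the section $s_i$, for $C^\infty(M)$-valued forms. (1) If $\widehat\omega$ is the $\mathfrak g_{\mathrm{equ}}$-basic form on $\mathrm{TLA}(P,\mathfrak g)$ with values in $\mathfrak g$ that corresponds to $\omega\in\Omega^q_{\mathrm{Lie}}(P,\mathfrak g)$, then $\omega^i_{\mathrm{loc}}=s_i^*\widehat\omega\in\Omega^q_{\mathrm{TLA}}(U_i,\mathfrak g)$, where $(s_i^*\widehat\omega)_x(X_k\oplus\gamma_k)=\widehat\omega_{s_i(x)}(T_xs_iX_k\oplus\gamma_k)$. The same holds for forms with complex coefficients, that is, with $\mathfrak g\otimes\mathbb C$ in place of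 $\mathfrak g$ as space of values. (2) Let $\nabla$ be a connection on $P$ with connection $1$-form $\omega_\nabla\in\Omega^1(P)\otimes\mathfrak g$, let $(E_a)$ be a basis of $\mathfrak g$ with dual basis $(\theta^a)$, write $\omega_\nabla=\omega_\nabla^a\otimes E_a$ and let $|k|=|\det (k(E_a,E_b))|$. Let $\omega^\nabla\in\Omega^1_{\mathrm{Lie}}(P,\mathfrak g)$, $\omega^\nabla(\mathsf X)=\omega_\nabla(\mathsf X)$, be the associated connection $1$-form on $\Gamma_G(TP)$. There is a unique form $\omega_{h,\omega}\in\Omega^n_{\mathrm{Lie}}(P)$, the volume form of the metric $h$ induced by $k$ and of $\nabla$, that is given in every local trivialization by $(-1)^n\sqrt{|k|}\,\omega_i^1\wedge\cdots\wedge\omega_i^n$, where $\omega^\nabla_{\mathrm{loc},i}=\omega_i^a E_a$. The unique $\mathfrak g_{\mathrm{equ}}$-basic form in $\Omega^n_{\mathrm{TLA}}(P)$ corresponding to $\omega_{h,\omega}$ is $$(-1)^n\sqrt{|k|}\,(\omega_\nabla^1-\theta^1)\wedge\cdots\wedge(\omega_\nabla^n-\theta^n).$$ This holds both for real-valued and for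 complex-valued forms. -/

import Mathlib

open scoped Manifold ContDiff Topology

noncomputable section

namespace Atiyah

/-! ### The Lie algebra of a smooth finite-dimensional Lie group -/

instance instCompleteSpaceOfFiniteDimensional (E : Type*) [NormedAddCommGroup E] [NormedSpace ℝ E]
    [FiniteDimensional ℝ E] : CompleteSpace E :=
  FiniteDimensional.complete ℝ E

instance instLieGroupMinSmoothness {E : Type*} [NormedAddCommGroup E] [NormedSpace ℝ E]
    {G : Type*} [TopologicalSpace G] [ChartedSpace E G] [Group G] [LieGroup 𝓘(ℝ, E) ∞ G] :
    LieGroup 𝓘(ℝ, E) (minSmoothness ℝ 3) G :=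
  LieGroup.of_le (n := ∞) (by
    rw [minSmoothness_of_isRCLikeNormedField]
    exact ENat.LEInfty.out)

/-- The Lie algebra `𝔤` of `G`: the tangent space at `1`, with the bracket of left-invariant
vector fields. As a vector space it is definitionally the model space `EG` of `G`. -/
abbrev LieAlg (EG : Type*) [NormedAddCommGroup EG] [NormedSpace ℝ EG]
    (G : Type*) [TopologicalSpace G] [ChartedSpace EG G] [Group G] : Type _ :=
  GroupLieAlgebra 𝓘(ℝ, EG) G

section Group

variable {EG : Type*} [NormedAddCommGroup EG] [NormedSpace ℝ EG]
  {G : Type*} [TopologicalSpace G] [ChartedSpace EG G] [Group G]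

/-- The adjoint action `Ad_g = T_1 (h ↦ g h g⁻¹)` of `G` on its Lie algebra. -/
def Ad (g : G) : LieAlg EG G →ₗ[ℝ] LieAlg EG G :=
  (show LieAlg EG G →L[ℝ] LieAlg EG G from
    mfderiv 𝓘(ℝ, EG) 𝓘(ℝ, EG) (fun h : G => g * h * g⁻¹) (1 : G)).toLinearMap

end Group

/-! ### Trivial Lie algebroids `TLA(N, 𝔤)` and their forms -/

section TLA

variable {E : Type*} [NormedAddCommGroup E] [NormedSpace ℝ E]
  {N : Type*} [TopologicalSpace N] [ChartedSpace E N] [IsManifold 𝓘(ℝ, E) ∞ N]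
  {EG : Type*} [NormedAddCommGroup EG] [NormedSpace ℝ EG]
  {G : Type*} [TopologicalSpace G] [ChartedSpace EG G] [Group G]
  {V : Type*} [NormedAddCommGroup V] [NormedSpace ℝ V]

/-- Smoothness of a vector field on a set. -/
def SmoothFieldOn (X : (x : N) → TangentSpace 𝓘(ℝ, E) x) (U : Set N) : Prop :=
  ContMDiffOn 𝓘(ℝ, E) (𝓘(ℝ, E).prod 𝓘(ℝ, E)) ∞
    (fun x => (⟨x, X x⟩ : TangentBundle 𝓘(ℝ, E) N)) U

variable (E EG G) in
/-- The fibre `T_x N ⊕ 𝔤` at `x` of the trivial Lie algebroid. -/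
abbrev TLAFiber (x : N) : Type _ := TangentSpace 𝓘(ℝ, E) x × LieAlg EG G

variable (E EG G) in
/-- Elements `X ⊕ γ` of `TLA(U, 𝔤)` for `U ⊆ N` open: a smooth vector field and a smooth
`𝔤`-valued function on `U` (the values outside `U` are irrelevant). -/
structure TLASection (U : Set N) where
  vec : (x : N) → TangentSpace 𝓘(ℝ, E) x
  alg : N → LieAlg EG G
  smooth_vec : SmoothFieldOn vec U
  smooth_alg : ContMDiffOn 𝓘(ℝ, E) 𝓘(ℝ, EG) ∞ (M' := EG) alg U

/-- The value of a section of `TLA(U, 𝔤)` at a point. -/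
def TLASection.val {U : Set N} (Y : TLASection E EG G U) (x : N) : TLAFiber E EG G x :=
  (Y.vec x, Y.alg x)

/-- The derivative `X · f` at a point, of a vector-valued function along a tangent vector. -/
def dirDeriv (f : N → V) (x : N) (v : TangentSpace 𝓘(ℝ, E) x) : V :=
  mfderiv 𝓘(ℝ, E) 𝓘(ℝ, V) f x v

/-- The bracket `[X ⊕ γ, Y ⊕ η] = [X, Y] ⊕ (X·η - Y·γ + [γ, η])` of the trivial Lie algebroid. -/
def tlaBracket (X Y : (x : N) → TangentSpace 𝓘(ℝ, E) x) (γ η : N → LieAlg EG G) (x : N) :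
    TLAFiber E EG G x :=
  (VectorField.mlieBracket 𝓘(ℝ, E) X Y x,
    (show LieAlg EG G from dirDeriv (V := EG) η x (X x))
      - (show LieAlg EG G from dirDeriv (V := EG) γ x (Y x)) + ⁅γ x, η x⁆)

variable (E N EG G V) in
/-- Fields of alternating `V`-valued `q`-linear maps on the fibres of the trivial Lie algebroid;
those that are smooth on `U` are the elements of total degree `q` of `Ω(U) ⊗ ⋀𝔤^* ⊗ V`. -/
abbrev TLAForm (q : ℕ) : Type _ := (x : N) → TLAFiber E EG G x [⋀^Fin q]→ₗ[ℝ] V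

/-- Smoothness on the open set `U`: smooth sections are mapped to smooth functions. -/
def TLAForm.SmoothOn {q : ℕ} (α : TLAForm E N EG G V q) (U : Set N) : Prop :=
  ∀ W : Set N, IsOpen W → W ⊆ U → ∀ Y : Fin q → TLASection E EG G W,
    ContMDiffOn 𝓘(ℝ, E) 𝓘(ℝ, V) ∞ (fun x => α x (fun k => (Y k).val x)) W

/-- A form in `Ω_TLA(U)`, as a multilinear map on sections with values in functions on `U`. -/
def TLAForm.onSections {q : ℕ} (α : TLAForm E N EG G V q) {U : Set N}
    (Y : Fin q → TLASection E EG G U) (x : U) : V :=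
  α x (fun k => (Y k).val x)

end TLA

/-! ### Principal bundles -/

section Bundle

variable (EM EP EG : Type*)
  [NormedAddCommGroup EM] [NormedSpace ℝ EM] [NormedAddCommGroup EP] [NormedSpace ℝ EP]
  [NormedAddCommGroup EG] [NormedSpace ℝ EG]
  {M P G : Type*} [TopologicalSpace M] [ChartedSpace EM M]
  [TopologicalSpace P] [ChartedSpace EP P]
  [TopologicalSpace G] [ChartedSpace EG G] [Group G]

/-- A smooth equivariant local trivialization `φ : P|_U ≃ U × G`. -/
structure LocalTriv (proj : P → M) (act : P → G → P) where
  baseSet : Set M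
  isOpen_baseSet : IsOpen baseSet
  toHomeo : OpenPartialHomeomorph P (M × G)
  source_eq : toHomeo.source = proj ⁻¹' baseSet
  target_eq : toHomeo.target = baseSet ×ˢ Set.univ
  smooth_toFun : ContMDiffOn 𝓘(ℝ, EP) (𝓘(ℝ, EM).prod 𝓘(ℝ, EG)) ∞ toHomeo toHomeo.source
  smooth_invFun : ContMDiffOn (𝓘(ℝ, EM).prod 𝓘(ℝ, EG)) 𝓘(ℝ, EP) ∞ toHomeo.symm toHomeo.target
  fst_eq : ∀ p ∈ toHomeo.source, (toHomeo p).1 = proj p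
  snd_act : ∀ p ∈ toHomeo.source, ∀ g : G, (toHomeo (act p g)).2 = (toHomeo p).2 * g

variable (M P G) in
/-- A smooth principal `G`-bundle `P → M` with right action `(p, g) ↦ p · g`. -/
structure PrincipalBundle where
  proj : P → M
  act : P → G → P
  smooth_proj : ContMDiff 𝓘(ℝ, EP) 𝓘(ℝ, EM) ∞ proj
  smooth_act : ContMDiff (𝓘(ℝ, EP).prod 𝓘(ℝ, EG)) 𝓘(ℝ, EP) ∞ (fun z : P × G => act z.1 z.2)
  act_one : ∀ p, act p 1 = p
  act_mul : ∀ p g h, act p (g * h) = act (act p g) h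
  proj_act : ∀ p g, proj (act p g) = proj p
  exists_localTriv : ∀ x : M, ∃ φ : LocalTriv EM EP EG proj act, x ∈ φ.baseSet

end Bundle

section Atiyah

variable {EM EP EG : Type*}
  [NormedAddCommGroup EM] [NormedSpace ℝ EM] [NormedAddCommGroup EP] [NormedSpace ℝ EP]
  [NormedAddCommGroup EG] [NormedSpace ℝ EG]
  {M P G : Type*} [TopologicalSpace M] [ChartedSpace EM M] [IsManifold 𝓘(ℝ, EM) ∞ M]
  [TopologicalSpace P] [ChartedSpace EP P] [IsManifold 𝓘(ℝ, EP) ∞ P]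
  [TopologicalSpace G] [ChartedSpace EG G] [Group G]
  {V : Type*} [NormedAddCommGroup V] [NormedSpace ℝ V]

/-- The local trivializations of a principal bundle. -/
abbrev PrincipalBundle.Triv (B : PrincipalBundle EM EP EG M P G) : Type _ :=
  LocalTriv EM EP EG B.proj B.act

variable (B : PrincipalBundle EM EP EG M P G)

/-- The fundamental vector field `ξ^P(p) = d/dt (p · exp (t ξ))|_{t = 0} = T_1 (g ↦ p · g) ξ`. -/
def fundamental (p : P) (ξ : LieAlg EG G) : TangentSpace 𝓘(ℝ, EP) p :=
  (mfderiv 𝓘(ℝ, EG) 𝓘(ℝ, EP) (fun g : G => B.act p g) 1 ξ : EP)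

/-- The derivative `T_p R_g : T_p P → T_{p · g} P` of the right translation by `g`. -/
def tangentAct (g : G) (p : P) : TangentSpace 𝓘(ℝ, EP) p →L[ℝ] TangentSpace 𝓘(ℝ, EP) (B.act p g) :=
  mfderiv 𝓘(ℝ, EP) 𝓘(ℝ, EP) (fun p : P => B.act p g) p

/-! ### The Atiyah Lie algebroid -/

/-- The ring `C^∞(M)`. -/
abbrev SmoothFun (EM M : Type*) [NormedAddCommGroup EM] [NormedSpace ℝ EM] [TopologicalSpace M]
    [ChartedSpace EM M] : Type _ :=
  C^∞⟮𝓘(ℝ, EM), M; 𝓘(ℝ, ℝ), ℝ⟯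

/-- Functions on `P` with values in `V`, as a module over `C^∞(M)` through `π^*`. -/
def FunOn (_B : PrincipalBundle EM EP EG M P G) (V : Type*) : Type _ := P → V

instance : AddCommGroup (FunOn B V) := inferInstanceAs (AddCommGroup (P → V))

instance : Module (SmoothFun EM M) (FunOn B V) where
  smul f v := fun p => f (B.proj p) • (v p : V)
  one_smul v := funext fun p => one_smul ℝ (v p : V)
  mul_smul f g v := funext fun p => mul_smul (f (B.proj p)) (g (B.proj p)) (v p : V)
  smul_zero f := funext fun p => smul_zero (A := V) (f (B.proj p))
  smul_add f v w := funext fun p => smul_add (f (B.proj p)) (v p : V) (w p : V)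
  add_smul f g v := funext fun p => add_smul (f (B.proj p)) (g (B.proj p)) (v p : V)
  zero_smul v := funext fun p => zero_smul ℝ (v p : V)

/-- Vector fields on `P`, as a module over `C^∞(M)` through `π^*`. -/
def FieldOn (_B : PrincipalBundle EM EP EG M P G) : Type _ := (p : P) → TangentSpace 𝓘(ℝ, EP) p

instance : AddCommGroup (FieldOn B) :=
  inferInstanceAs (AddCommGroup ((p : P) → TangentSpace 𝓘(ℝ, EP) p))

instance : Module (SmoothFun EM M) (FieldOn B) where
  smul f X := fun p => f (B.proj p) • (X p : TangentSpace 𝓘(ℝ, EP) p)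
  one_smul X := funext fun p => one_smul ℝ (X p : TangentSpace 𝓘(ℝ, EP) p)
  mul_smul f g X := funext fun p =>
    mul_smul (f (B.proj p)) (g (B.proj p)) (X p : TangentSpace 𝓘(ℝ, EP) p)
  smul_zero f := funext fun p => smul_zero (A := TangentSpace 𝓘(ℝ, EP) p) (f (B.proj p))
  smul_add f X Y := funext fun p =>
    smul_add (f (B.proj p)) (X p : TangentSpace 𝓘(ℝ, EP) p) (Y p : TangentSpace 𝓘(ℝ, EP) p)
  add_smul f g X := funext fun p =>
    add_smul (f (B.proj p)) (g (B.proj p)) (X p : TangentSpace 𝓘(ℝ, EP) p)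
  zero_smul X := funext fun p => zero_smul ℝ (X p : TangentSpace 𝓘(ℝ, EP) p)

/-- `Γ_G(TP)`: the smooth vector fields `X` on `P` with `R_{g *} X = X` for all `g`, a
`C^∞(M)`-module. -/
def InvariantField : Submodule (SmoothFun EM M) (FieldOn B) where
  carrier := {X | SmoothFieldOn (E := EP) (N := P) X Set.univ ∧
    ∀ (g : G) (p : P), tangentAct B g p (X p) = X (B.act p g)}
  add_mem' {X Y} hX hY := by
    refine ⟨ContMDiffOn.add_section (s := X) (t := Y) hX.1 hY.1, fun g p => ?_⟩
    have h := (tangentAct B g p).map_add (X p) (Y p)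
    rw [hX.2, hY.2] at h
    exact h
  zero_mem' := ⟨(Bundle.contMDiff_zeroSection ℝ
    (TangentSpace 𝓘(ℝ, EP) : P → Type _)).contMDiffOn, fun g p => (tangentAct B g p).map_zero⟩
  smul_mem' f X hX := by
    refine ⟨ContMDiffOn.smul_section (s := X) ((f.contMDiff.comp B.smooth_proj).contMDiffOn) hX.1,
      fun g p => ?_⟩
    have h := (tangentAct B g p).map_smul (f (B.proj p)) (X p)
    have e : f (B.proj (B.act p g)) = f (B.proj p) := by rw [B.proj_act]
    rw [hX.2] at h
    exact h.trans (congrArg (fun c : ℝ => c • X (B.act p g)) e.symm)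

/-- Coefficients for forms: a space `V` with the operators of `G` and of `𝔤` on it. Only the
instances `adjoint`, `adjointC` and `scalar` below are used. -/
structure Coeff (EG G V : Type*) [NormedAddCommGroup EG] [NormedSpace ℝ EG] [TopologicalSpace G]
    [ChartedSpace EG G] [Group G] [NormedAddCommGroup V] [NormedSpace ℝ V] where
  act : G → V →ₗ[ℝ] V
  infAct : LieAlg EG G → V →ₗ[ℝ] V

/-- The `C^∞(M)`-module of smooth maps `v : P → V` with `v (p · g) = g⁻¹ · v p`. For the adjoint
coefficients it is the kernel `Γ_G(P, 𝔤)` of the Atiyah Lie algebroid; for trivial scalar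
coefficients it consists of the invariant functions, that is of `π^* C^∞(M)`. -/
def EquivariantMap (C : Coeff EG G V) : Submodule (SmoothFun EM M) (FunOn B V) where
  carrier := {v | ContMDiff 𝓘(ℝ, EP) 𝓘(ℝ, V) ∞ (v : P → V) ∧
    ∀ (p : P) (g : G), v (B.act p g) = C.act g⁻¹ (v p)}
  add_mem' {v w} hv hw := by
    refine ⟨ContMDiff.add (G := V) hv.1 hw.1, fun p g => ?_⟩
    have h := (C.act g⁻¹).map_add (v p) (w p)
    rw [← hv.2, ← hw.2] at h
    exact h.symm
  zero_mem' := ⟨contMDiff_const, fun p g => ((C.act g⁻¹).map_zero).symm⟩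
  smul_mem' f v hv := by
    refine ⟨ContMDiff.smul (f.contMDiff.comp B.smooth_proj) hv.1, fun p g => ?_⟩
    have h := (C.act g⁻¹).map_smul (f (B.proj p)) (v p)
    have e : f (B.proj (B.act p g)) = f (B.proj p) := by rw [B.proj_act]
    rw [← hv.2] at h
    exact (congrArg (fun c : ℝ => c • (v (B.act p g) : V)) e).trans h.symm

/-- Forms of degree `q` on the Atiyah Lie algebroid `Γ_G(TP)`: the alternating
`C^∞(M)`-multilinear maps to the module of equivariant maps. This is `Ω_lie^q(P, 𝔤)` for adjoint
coefficients and `Ω_lie^q(P)` for scalar ones. -/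
abbrev AtiyahForm (C : Coeff EG G V) (q : ℕ) : Type _ :=
  InvariantField B [⋀^Fin q]→ₗ[SmoothFun EM M] EquivariantMap B C

variable {B}

/-- The value at `p` of an invariant vector field. -/
def InvariantField.val (X : InvariantField B) (p : P) : TangentSpace 𝓘(ℝ, EP) p := X.1 p

/-- The value at `p` of `ω(X_1, …, X_q)`. -/
def AtiyahForm.val {C : Coeff EG G V} {q : ℕ} (α : AtiyahForm B C q)
    (X : Fin q → InvariantField B) (p : P) : V := (α X).1 p

/-! ### Local trivializations -/

/-- The local section `s(x) = φ⁻¹(x, e)`. -/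
def LocalTriv.sec (φ : B.Triv) (x : M) : P := φ.toHomeo.symm (x, 1)

/-- The isomorphism `Ψ`: `Ψ(γ)(p) = Ad_{g⁻¹} γ(x)` for `p = s(x) · g`. -/
def LocalTriv.Psi (φ : B.Triv) (γ : M → LieAlg EG G) (p : P) : LieAlg EG G :=
  Ad (φ.toHomeo p).2⁻¹ (γ (B.proj p))

/-- The inverse of `Ψ`: `Ψ⁻¹(v) = s^* v`. -/
def LocalTriv.PsiInv (φ : B.Triv) (v : P → V) (x : M) : V := v (φ.sec x)

/-- The flat connection `∇⁰`: `∇⁰_X(p) = T R_g (T_x s (X(x)))` for `p = s(x) · g`. -/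
def LocalTriv.nablaZero (φ : B.Triv) (X : (x : M) → TangentSpace 𝓘(ℝ, EM) x) (p : P) :
    TangentSpace 𝓘(ℝ, EP) p :=
  (tangentAct B (φ.toHomeo p).2 (φ.sec (B.proj p))
    (mfderiv 𝓘(ℝ, EM) 𝓘(ℝ, EP) φ.sec (B.proj p) (X (B.proj p))) : EP)

variable (B) in
/-- The inclusion `ι(v)(p) = - v(p)^P(p)` of the kernel. -/
def iota (v : P → LieAlg EG G) (p : P) : TangentSpace 𝓘(ℝ, EP) p := - fundamental B p (v p)

/-- `S(X ⊕ γ) = ∇⁰_X + ι(Ψ(γ))`, an invariant vector field on `P|_U`. -/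
def LocalTriv.S (φ : B.Triv) (Y : TLASection EM EG G φ.baseSet) (p : P) :
    TangentSpace 𝓘(ℝ, EP) p :=
  φ.nablaZero Y.vec p + iota B (φ.Psi Y.alg) p

open Classical in
/-- The restriction of a form to the invariant vector fields `Z_k` on some `P|_U`: its value at `p`
is that of `ω(X_1, …, X_q)`, where the `X_k` are global invariant vector fields which coincide
with the `Z_k` over a neighbourhood of `π(p)`. -/
def AtiyahForm.restrict {C : Coeff EG G V} {q : ℕ} (α : AtiyahForm B C q)
    (Z : Fin q → (p : P) → TangentSpace 𝓘(ℝ, EP) p) (p : P) : V :=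
  if h : ∃ X : Fin q → InvariantField B, ∃ W ∈ 𝓝 (B.proj p), ∀ k, ∀ p' : P, B.proj p' ∈ W →
      (X k).val p' = Z k p'
  then α.val h.choose p else 0

/-- The local trivialization `ω_loc = Ψ⁻¹ ∘ ω ∘ S` of a form, as a map on sections of
`TLA(U, 𝔤)`. -/
def AtiyahForm.loc {C : Coeff EG G V} {q : ℕ} (α : AtiyahForm B C q) (φ : B.Triv)
    (Y : Fin q → TLASection EM EG G φ.baseSet) (x : φ.baseSet) : V :=
  φ.PsiInv (α.restrict (fun k => φ.S (Y k))) x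

/-- The pull-back `s^* : Ω_TLA(P) → Ω_TLA(U)`, which is the identity on `𝔤`:
`(s^* ω)_x (X_k ⊕ γ_k) = ω_{s(x)} (T_x s X_k ⊕ γ_k)`. -/
def TLAForm.pullback {q : ℕ} (α : TLAForm EP P EG G V q) (φ : B.Triv) :
    TLAForm EM M EG G V q :=
  fun x => (α (φ.sec x)).compLinearMap
    (LinearMap.prodMap (mfderiv 𝓘(ℝ, EM) 𝓘(ℝ, EP) φ.sec x).toLinearMap LinearMap.id)

/-! ### Basic forms for `𝔤_equ = {ξ^P ⊕ ξ}` -/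

variable (B) in
/-- Horizontality: `i_{ξ^P ⊕ ξ} ω = 0` for all `ξ`. -/
def IsHorizontal {q : ℕ} (α : TLAForm EP P EG G V q) : Prop :=
  ∀ (ξ : LieAlg EG G) (p : P) (k : Fin q) (Y : Fin q → TLAFiber EP EG G p),
    Y k = (fundamental B p ξ, ξ) → α p Y = 0

variable (B) in
/-- The Lie derivative along `ξ^P ⊕ ξ` of a form on `TLA(P, 𝔤)`, evaluated on sections:
`(ξ^P ⊕ ξ) · ω(Y_1, …, Y_q) - ∑ ω(Y_1, …, [ξ^P ⊕ ξ, Y_k], …, Y_q)`, where `X ⊕ γ` operates on a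
`V`-valued function `f` by `X · f + γ · f`. -/
def lieDeriv (C : Coeff EG G V) {q : ℕ} (ξ : LieAlg EG G) (α : TLAForm EP P EG G V q)
    (Y : Fin q → TLASection EP EG G (Set.univ : Set P)) (p : P) : V :=
  dirDeriv (fun p' => α p' (fun k => (Y k).val p')) p (fundamental B p ξ)
    + C.infAct ξ (α p (fun k => (Y k).val p))
    - ∑ k, α p (Function.update (fun j => (Y j).val p) k
        (tlaBracket (fun p' => fundamental B p' ξ) (Y k).vec (fun _ => ξ) (Y k).alg p))

variable (B) in
/-- The `𝔤_equ`-basic forms on `TLA(P, 𝔤)`: smooth, horizontal and invariant. -/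
def IsBasic (C : Coeff EG G V) {q : ℕ} (α : TLAForm EP P EG G V q) : Prop :=
  α.SmoothOn Set.univ ∧ IsHorizontal B α ∧
    ∀ (ξ : LieAlg EG G) (Y : Fin q → TLASection EP EG G (Set.univ : Set P)) (p : P),
      lieDeriv B C ξ α Y p = 0

/-- `λ(ω') = ω`, the relation between basic forms `ω'` on `TLA(P, 𝔤)` and forms `ω` on the Atiyah
Lie algebroid: `ω(X_1, …, X_q)(p) = ω'(X'_1, …, X'_q)(p)` for all families
`X'_k = X_k ⊕ 0 + (v_k^P ⊕ v_k)` in `Γ_G(TP) ⊕ Z` over `X_1, …, X_q`. Here `Z` is the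
`C^∞(P)`-module generated by `𝔤_equ`; its elements are the `v^P ⊕ v` with `v : P → 𝔤` smooth. -/
def Corresponds {C : Coeff EG G V} {q : ℕ} (β : TLAForm EP P EG G V q) (α : AtiyahForm B C q) :
    Prop :=
  ∀ (X : Fin q → InvariantField B) (v : Fin q → P → LieAlg EG G),
    (∀ k, ContMDiff 𝓘(ℝ, EP) 𝓘(ℝ, EG) ∞ (M' := EG) (v k)) →
    ∀ p : P, α.val X p = β p (fun k => ((X k).val p + fundamental B p (v k p), v k p))

/-! ### The coefficients -/

section Coefficients

variable (EG G) [FiniteDimensional ℝ EG] [LieGroup 𝓘(ℝ, EG) ∞ G]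

/-- Kernel-valued forms: `𝔤` with `Ad` and `ad`. -/
def adjoint : Coeff EG G EG where
  act g := (Ad g : LieAlg EG G →ₗ[ℝ] LieAlg EG G)
  infAct ξ := (LieAlgebra.ad ℝ (LieAlg EG G) ξ : LieAlg EG G →ₗ[ℝ] LieAlg EG G)

/-- Kernel-valued forms with complex coefficients: `𝔤 ⊗ ℂ = 𝔤 ⊕ i 𝔤`, a pair being the real and
the imaginary part. -/
def adjointC : Coeff EG G (EG × EG) where
  act g := ((adjoint EG G).act g).prodMap ((adjoint EG G).act g)
  infAct ξ := ((adjoint EG G).infAct ξ).prodMap ((adjoint EG G).infAct ξ)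

/-- Function-valued forms: real or complex scalars with trivial operators. -/
def scalar (𝕜 : Type*) [RCLike 𝕜] : Coeff EG G 𝕜 where
  act _ := LinearMap.id
  infAct _ := 0

end Coefficients

/-! ### Connections and the volume form -/

section Connection

variable [FiniteDimensional ℝ EG] [LieGroup 𝓘(ℝ, EG) ∞ G]

variable (B) in
/-- A connection on the principal bundle, given by its connection `1`-form `ω_∇`. -/
structure Connection where
  form : (p : P) → TangentSpace 𝓘(ℝ, EP) p →ₗ[ℝ] LieAlg EG G
  smooth_form : ∀ (W : Set P), IsOpen W → ∀ X : (p : P) → TangentSpace 𝓘(ℝ, EP) p,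
    SmoothFieldOn X W → ContMDiffOn 𝓘(ℝ, EP) 𝓘(ℝ, EG) ∞ (M' := EG) (fun p => form p (X p)) W
  form_fundamental : ∀ (p : P) (ξ : LieAlg EG G), form p (fundamental B p ξ) = ξ
  form_act : ∀ (g : G) (p : P) (w : TangentSpace 𝓘(ℝ, EP) p),
    form (B.act p g) (tangentAct B g p w) = Ad g⁻¹ (form p w)

/-- The connection `1`-form `ω^∇ ∈ Ω_lie^1(P, 𝔤)` of the algebroid connection `∇` (the horizontal
lift), characterized by `X = ∇_{π_* X} - ι(ω^∇(X))`: the restriction of `ω_∇` to `Γ_G(TP)`. -/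
def Connection.lieForm (A : Connection B) : AtiyahForm B (adjoint EG G) 1 where
  toFun X := ⟨fun p => (A.form p ((X 0).val p) : EG),
    contMDiffOn_univ.1 (A.smooth_form Set.univ isOpen_univ _ (X 0).2.1), fun p g => by
      have h := A.form_act g p ((X 0).val p)
      rw [show tangentAct B g p ((X 0).val p) = (X 0).val (B.act p g) from (X 0).2.2 g p] at h
      exact h⟩
  map_update_add' X i Y Z := by
    obtain rfl : i = 0 := Subsingleton.elim _ _
    refine Subtype.ext (funext fun p => ?_)
    simp only [Function.update_self]
    exact (A.form p).map_add (Y.val p) (Z.val p)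
  map_update_smul' X i f Y := by
    obtain rfl : i = 0 := Subsingleton.elim _ _
    refine Subtype.ext (funext fun p => ?_)
    simp only [Function.update_self]
    exact (A.form p).map_smul (f (B.proj p)) (Y.val p)
  map_eq_zero_of_eq' X i j _ hij := (hij (Subsingleton.elim _ _)).elim

/-- `√|k|`, with `|k|` the absolute value of the determinant of the matrix `k(E_a, E_b)` of the
Killing form. In each local trivialization it is also `√|h_loc|`, as `h_loc = k`. -/
def sqrtKilling {n : ℕ} (b : Module.Basis (Fin n) ℝ (LieAlg EG G)) : ℝ :=
  Real.sqrt |(Matrix.of fun i j => killingForm ℝ (LieAlg EG G) (b i) (b j)).det|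

/-- The wedge product `α^1 ∧ … ∧ α^n` of linear forms, with value `det (α^i(Y_j))`. -/
def wedge {W : Type*} [AddCommGroup W] [Module ℝ W] {n : ℕ} (α : Fin n → W →ₗ[ℝ] ℝ) :
    W [⋀^Fin n]→ₗ[ℝ] ℝ :=
  Matrix.detRowAlternating.compLinearMap (LinearMap.pi α)

/-- `ω` is the volume form `ω_{h, ω}` of the metric given by the Killing form and of the connection:
in every local trivialization, `ω_loc = (-1)^n √|h_loc| ω^1 ∧ … ∧ ω^n`, where the `1`-forms `ω^a`
(the mixed basis) are the components of the local trivialization of the connection `1`-form. -/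
def IsVolumeForm {𝕜 : Type*} [RCLike 𝕜] {n : ℕ} (b : Module.Basis (Fin n) ℝ (LieAlg EG G))
    (A : Connection B) (α : AtiyahForm B (scalar EG G 𝕜) n) : Prop :=
  ∀ (φ : B.Triv) (Y : Fin n → TLASection EM EG G φ.baseSet) (x : φ.baseSet),
    α.loc φ Y x = (((-1) ^ n * sqrtKilling b *
      (Matrix.of fun i j => b.coord i (A.lieForm.loc φ (fun _ => Y j) x)).det : ℝ) : 𝕜)

/-- The form `(-1)^n √|k| (ω_∇^1 - θ^1) ∧ … ∧ (ω_∇^n - θ^n)` on `TLA(P, 𝔤)`, where `ω_∇^a` are the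
components of the connection form in the basis `b` and `θ^a` is the dual basis. -/
def volumeTLAForm (𝕜 : Type*) [RCLike 𝕜] {n : ℕ} (b : Module.Basis (Fin n) ℝ (LieAlg EG G))
    (A : Connection B) : TLAForm EP P EG G 𝕜 n :=
  fun p => (RCLike.ofRealCLM (K := 𝕜)).toLinearMap.compAlternatingMap
    (((-1 : ℝ) ^ n * sqrtKilling b) • wedge fun i =>
      (b.coord i ∘ₗ A.form p) ∘ₗ LinearMap.fst ℝ (TangentSpace 𝓘(ℝ, EP) p) (LieAlg EG G)
        - b.coord i ∘ₗ LinearMap.snd ℝ (TangentSpace 𝓘(ℝ, EP) p) (LieAlg EG G))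

end Connection

end Atiyah

end Atiyah

end

/-!
A form on `TLA(P, 𝔤)` and a form on `Γ_G(TP)` correspond when they agree on the lifts
`(X_k + v_k^P) ⊕ v_k`. An element `X_k ⊕ γ_k` over the domain of a trivialization gives the
invariant field `S(X_k ⊕ γ_k)`, whose value at `s(x)` is `T_x s X_k - γ_k^P`; taking `v_k = γ_k` in
the correspondence cancels the vertical part and leaves `(s^* ω̂)_x`. Since bump functions on `M`
extend invariant fields, these fields have arbitrary values at every point, so a form on
`TLA(P, 𝔤)` is determined by the form to which it corresponds.

For the volume form, let `D` be a `V`-valued alternating map on `𝔤`. The form `ω_∇ - θ` vanishes on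
`ξ^P ⊕ ξ`, and its Lie derivative along `ξ^P ⊕ ξ` is `-[ξ, ω_∇ - θ]`. Hence `D(ω_∇ - θ, …, ω_∇ - θ)`
is basic as soon as `D` is `𝔤`-equivariant, and for a `G`-equivariant `D` it corresponds to
`D(ω_∇, …, ω_∇)`. For `D = (-1)^n √|k| θ^1 ∧ … ∧ θ^n` the derivation of the determinant induced by
`ad ξ` is multiplication by `tr (ad ξ) = 0`, and on a connected group the vanishing of the
derivatives of `g ↦ D(Ad_{g⁻¹} v)` gives invariance under `G`.
-/

noncomputable section

namespace Atiyah

section Calculus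

variable {E Z F : Type*} [NormedAddCommGroup E] [NormedSpace ℝ E]
  [NormedAddCommGroup Z] [NormedSpace ℝ Z] [NormedAddCommGroup F] [NormedSpace ℝ F]

lemma fderiv_prodMk_left_apply {f : E × Z → F} {x : E} {z : Z}
    (hf : DifferentiableAt ℝ f (x, z)) (w : E) :
    fderiv ℝ (fun x' => f (x', z)) x w = fderiv ℝ f (x, z) (w, 0) := by
  have h : HasFDerivAt (fun x' => f (x', z)) ((fderiv ℝ f (x, z)).comp (.inl ℝ E Z)) x :=
    hf.hasFDerivAt.comp x (hasFDerivAt_prodMk_left x z)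
  simp [h.fderiv]

lemma fderiv_prodMk_right_apply {f : E × Z → F} {x : E} {z : Z}
    (hf : DifferentiableAt ℝ f (x, z)) (ξ : Z) :
    fderiv ℝ (fun z' => f (x, z')) z ξ = fderiv ℝ f (x, z) (0, ξ) := by
  have h : HasFDerivAt (fun z' => f (x, z')) ((fderiv ℝ f (x, z)).comp (.inr ℝ E Z)) z :=
    hf.hasFDerivAt.comp z (hasFDerivAt_prodMk_right x z)
  simp [h.fderiv]

lemma eventually_differentiableAt {f : E → F} {x : E} (hf : ContDiffAt ℝ 2 f x) :
    ∀ᶠ x' in 𝓝 x, DifferentiableAt ℝ f x' :=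
  (hf.eventually (by simp)).mono fun _ h => h.differentiableAt (by simp)

lemma hasFDerivAt_fderiv {f : E → F} {x : E} (hf : ContDiffAt ℝ 2 f x) :
    HasFDerivAt (fderiv ℝ f) (fderiv ℝ (fderiv ℝ f) x) x :=
  ((hf.fderiv_right (m := 1) (by norm_num)).differentiableAt (by simp)).hasFDerivAt

lemma hasFDerivAt_fderiv_prodMk_left {f : E × Z → F} {x : E} {z : Z}
    (hf : ContDiffAt ℝ 2 f (x, z)) (w : E) :
    HasFDerivAt (fun z' => fderiv ℝ (fun x' => f (x', z')) x w)
      (((fderiv ℝ (fderiv ℝ f) (x, z)).comp (.inr ℝ E Z)).flip (w, 0)) z := by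
  have hD := (hasFDerivAt_fderiv hf).comp z (hasFDerivAt_prodMk_right x z)
  refine ((hD.clm_apply (hasFDerivAt_const ((w, 0) : E × Z) z)).congr_of_eventuallyEq
    ?_).congr_fderiv (by simp)
  filter_upwards [(Continuous.prodMk_right x).continuousAt.eventually
    (eventually_differentiableAt hf)] with z' hz'
  exact fderiv_prodMk_left_apply hz' w

lemma hasFDerivAt_fderiv_prodMk_right {f : E × Z → F} {x : E} {z : Z}
    (hf : ContDiffAt ℝ 2 f (x, z)) (ξ : Z) :
    HasFDerivAt (fun x' => fderiv ℝ (fun z' => f (x', z')) z ξ)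
      (((fderiv ℝ (fderiv ℝ f) (x, z)).comp (.inl ℝ E Z)).flip (0, ξ)) x := by
  have hD := HasFDerivAt.comp (f := (·, z)) x (hasFDerivAt_fderiv hf) (hasFDerivAt_prodMk_left x z)
  refine ((hD.clm_apply (hasFDerivAt_const ((0, ξ) : E × Z) x)).congr_of_eventuallyEq
    ?_).congr_fderiv (by simp)
  filter_upwards [(Continuous.prodMk_left z).continuousAt.eventually
    (eventually_differentiableAt hf)] with x' hx'
  exact fderiv_prodMk_right_apply hx' ξ

lemma fderiv_fderiv_prodMk_comm {f : E × Z → F} {x : E} {z : Z}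
    (hf : ContDiffAt ℝ 2 f (x, z)) (w : E) (ξ : Z) :
    fderiv ℝ (fun z' => fderiv ℝ (fun x' => f (x', z')) x w) z ξ =
      fderiv ℝ (fun x' => fderiv ℝ (fun z' => f (x', z')) z ξ) x w := by
  rw [(hasFDerivAt_fderiv_prodMk_left hf w).fderiv, (hasFDerivAt_fderiv_prodMk_right hf ξ).fderiv]
  exact hf.isSymmSndFDerivAt (by simp) (0, ξ) (w, 0)

lemma hasFDerivAt_pullback_family {Φ : E × Z → E} {x : E} {z : Z}
    (hΦ : ContDiffAt ℝ 2 Φ (x, z)) (hid : ∀ᶠ x' in 𝓝 x, Φ (x', z) = x')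
    {θ : E → E →L[ℝ] F} (hθ : DifferentiableAt ℝ θ x) (w : E) :
    HasFDerivAt (fun z' => θ (Φ (x, z')) (fderiv ℝ (fun x' => Φ (x', z')) x w))
      (((fderiv ℝ θ x).comp (fderiv ℝ (fun z' => Φ (x, z')) z)).flip w +
        (θ x).comp (fderiv ℝ (fun z' => fderiv ℝ (fun x' => Φ (x', z')) x w) z)) z := by
  have hΦx : Φ (x, z) = x := hid.self_of_nhds
  have hΦz : HasFDerivAt (fun z' => Φ (x, z')) (fderiv ℝ (fun z' => Φ (x, z')) z) z :=
    ((hΦ.differentiableAt (by simp)).comp z (by fun_prop)).hasFDerivAt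
  have hθz : HasFDerivAt (fun z' => θ (Φ (x, z')))
      ((fderiv ℝ θ x).comp (fderiv ℝ (fun z' => Φ (x, z')) z)) z :=
    HasFDerivAt.comp z (hΦx.symm ▸ hθ.hasFDerivAt) hΦz
  have hw : fderiv ℝ (fun x' => Φ (x', z)) x w = w := by
    rw [Filter.EventuallyEq.fderiv_eq hid, fderiv_fun_id, ContinuousLinearMap.id_apply]
  refine (hθz.clm_apply
    (hasFDerivAt_fderiv_prodMk_left hΦ w).differentiableAt.hasFDerivAt).congr_fderiv ?_
  rw [hw, hΦx, add_comm]

theorem fderiv_pullback_family {Φ : E × Z → E} {x : E} {z : Z}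
    (hΦ : ContDiffAt ℝ 2 Φ (x, z)) (hid : ∀ᶠ x' in 𝓝 x, Φ (x', z) = x')
    {θ : E → E →L[ℝ] F} (hθ : DifferentiableAt ℝ θ x) {y : E → E} (hy : DifferentiableAt ℝ y x)
    (ξ : Z) :
    fderiv ℝ (fun z' => θ (Φ (x, z')) (fderiv ℝ (fun x' => Φ (x', z')) x (y x))) z ξ =
      fderiv ℝ (fun x' => θ x' (y x')) x (fderiv ℝ (fun z' => Φ (x, z')) z ξ) -
        θ x (VectorField.lieBracket ℝ (fun x' => fderiv ℝ (fun z' => Φ (x', z')) z ξ) y x) := by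
  rw [(hasFDerivAt_pullback_family hΦ hid hθ (y x)).fderiv,
    (hθ.hasFDerivAt.clm_apply hy.hasFDerivAt).fderiv]
  simp only [VectorField.lieBracket, fderiv_fderiv_prodMk_comm hΦ, add_apply,
    ContinuousLinearMap.flip_apply, ContinuousLinearMap.comp_apply, map_sub]
  abel

end Calculus

section ModelDeriv

variable (E₁ E₂ E₃ : Type*) [NormedAddCommGroup E₁] [NormedSpace ℝ E₁]
  [NormedAddCommGroup E₂] [NormedSpace ℝ E₂] [NormedAddCommGroup E₃] [NormedSpace ℝ E₃]
  {N₁ N₂ N₃ : Type*} [TopologicalSpace N₁] [ChartedSpace E₁ N₁]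
  [TopologicalSpace N₂] [ChartedSpace E₂ N₂] [TopologicalSpace N₃] [ChartedSpace E₃ N₃]

/-- The derivative of a map of manifolds, as a linear map of the model spaces. The tangent spaces
being copies of the model spaces, this is `mfderiv` up to its type, which no longer depends on the
base points: identities between derivatives at propositionally equal points can be stated. -/
def modelDeriv (f : N₁ → N₂) (p : N₁) : E₁ →L[ℝ] E₂ :=
  mfderiv 𝓘(ℝ, E₁) 𝓘(ℝ, E₂) f p

variable {E₁ E₂ E₃}

lemma modelDeriv_comp {g : N₂ → N₃} {f : N₁ → N₂} {h : N₁ → N₃} {p : N₁} {q : N₂}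
    (hh : ∀ᶠ x in 𝓝 p, h x = g (f x)) (hq : f p = q)
    (hg : MDifferentiableAt 𝓘(ℝ, E₂) 𝓘(ℝ, E₃) g q)
    (hf : MDifferentiableAt 𝓘(ℝ, E₁) 𝓘(ℝ, E₂) f p) (v : E₁) :
    modelDeriv E₁ E₃ h p v = modelDeriv E₂ E₃ g q (modelDeriv E₁ E₂ f p v) := by
  subst hq
  have hderiv : modelDeriv E₁ E₃ h p = modelDeriv E₁ E₃ (g ∘ f) p :=
    Filter.EventuallyEq.mfderiv_eq hh
  exact congrArg (fun L : E₁ →L[ℝ] E₃ => L v) (hderiv.trans (mfderiv_comp p hg hf))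

lemma modelDeriv_of_eventually_eq_self {h : N₁ → N₁} {p : N₁} (hh : ∀ᶠ x in 𝓝 p, h x = x)
    (v : E₁) : modelDeriv E₁ E₁ h p v = v := by
  have hderiv : modelDeriv E₁ E₁ h p = modelDeriv E₁ E₁ id p := Filter.EventuallyEq.mfderiv_eq hh
  exact congrArg (fun L : E₁ →L[ℝ] E₁ => L v) (hderiv.trans mfderiv_id)

end ModelDeriv

section Chart

variable {E : Type*} [NormedAddCommGroup E] [NormedSpace ℝ E]
  {N : Type*} [TopologicalSpace N] [ChartedSpace E N]
  {F : Type*} [NormedAddCommGroup F] [NormedSpace ℝ F]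

/-- The derivative of the chart at `p`, as an endomorphism of the model space. -/
def chartDeriv (p q : N) : E →L[ℝ] E :=
  modelDeriv E E (extChartAt 𝓘(ℝ, E) p) q

/-- The derivative of the inverse of the chart at `p`, as an endomorphism of the model space. -/
def chartSymmDeriv (p : N) (x : E) : E →L[ℝ] E :=
  mfderivWithin 𝓘(ℝ, E) 𝓘(ℝ, E) (extChartAt 𝓘(ℝ, E) p).symm (Set.range 𝓘(ℝ, E)) x

/-- A vector field, read in the chart at `p`. -/
def chartField (X : (p : N) → TangentSpace 𝓘(ℝ, E) p) (p : N) (x : E) : E :=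
  chartDeriv p ((extChartAt 𝓘(ℝ, E) p).symm x) (X ((extChartAt 𝓘(ℝ, E) p).symm x) : E)

/-- A vector-valued one-form, read in the chart at `p`. -/
def chartForm [FiniteDimensional ℝ E] (θ : (p : N) → TangentSpace 𝓘(ℝ, E) p →ₗ[ℝ] F) (p : N)
    (x : E) : E →L[ℝ] F :=
  LinearMap.toContinuousLinearMap (𝕜 := ℝ) (E := E)
    ((show E →ₗ[ℝ] F from θ ((extChartAt 𝓘(ℝ, E) p).symm x)) ∘ₗ (chartSymmDeriv p x).toLinearMap)

lemma chartField_apply (X : (p : N) → TangentSpace 𝓘(ℝ, E) p) {p q : N}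
    (hq : q ∈ (extChartAt 𝓘(ℝ, E) p).source) :
    chartField X p (extChartAt 𝓘(ℝ, E) p q) = chartDeriv (E := E) p q (X q) := by
  rw [chartField, (extChartAt 𝓘(ℝ, E) p).left_inv hq]

lemma extChartAt_target_mem_nhds_self (p : N) :
    (extChartAt 𝓘(ℝ, E) p).target ∈ 𝓝 (extChartAt 𝓘(ℝ, E) p p) :=
  extChartAt_target_mem_nhds (I := 𝓘(ℝ, E)) p

variable [IsManifold 𝓘(ℝ, E) ∞ N]

/-- Smoothness of a vector-valued one-form: smooth vector fields are mapped to smooth functions. -/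
def IsSmoothForm (θ : (p : N) → TangentSpace 𝓘(ℝ, E) p →ₗ[ℝ] F) : Prop :=
  ∀ W : Set N, IsOpen W → ∀ X : (p : N) → TangentSpace 𝓘(ℝ, E) p, SmoothFieldOn X W →
    ContMDiffOn 𝓘(ℝ, E) 𝓘(ℝ, F) ∞ (fun p => θ p (X p)) W

lemma chartDeriv_self (p : N) : chartDeriv p p = ContinuousLinearMap.id ℝ E :=
  mfderiv_extChartAt_self (I := 𝓘(ℝ, E)) (x := p)

lemma chartSymmDeriv_chartDeriv {p : N} {x : E} (hx : x ∈ (extChartAt 𝓘(ℝ, E) p).target) (w : E) :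
    chartSymmDeriv p x (chartDeriv p ((extChartAt 𝓘(ℝ, E) p).symm x) w) = w :=
  congrArg (fun L : E →L[ℝ] E => L w)
    (mfderivWithin_extChartAt_symm_comp_mfderiv_extChartAt (I := 𝓘(ℝ, E)) hx)

lemma chartField_self (X : (p : N) → TangentSpace 𝓘(ℝ, E) p) (p : N) :
    chartField X p (extChartAt 𝓘(ℝ, E) p p) = X p := by
  rw [chartField_apply X (mem_extChartAt_source p), chartDeriv_self]
  rfl

lemma chartForm_apply [FiniteDimensional ℝ E] (θ : (p : N) → TangentSpace 𝓘(ℝ, E) p →ₗ[ℝ] F)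
    {p q : N} (hq : q ∈ (extChartAt 𝓘(ℝ, E) p).source) (w : E) :
    chartForm θ p (extChartAt 𝓘(ℝ, E) p q) (chartDeriv p q w) = θ q w := by
  have happly : ∀ q' : N, (extChartAt 𝓘(ℝ, E) p).symm (extChartAt 𝓘(ℝ, E) p q) = q' →
      chartForm θ p (extChartAt 𝓘(ℝ, E) p q) (chartDeriv p q' w) = θ q' w := by
    rintro _ rfl
    exact congrArg (fun u : E => θ ((extChartAt 𝓘(ℝ, E) p).symm (extChartAt 𝓘(ℝ, E) p q)) u)
      (chartSymmDeriv_chartDeriv ((extChartAt 𝓘(ℝ, E) p).map_source hq) w)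
  exact happly q ((extChartAt 𝓘(ℝ, E) p).left_inv hq)

lemma chartForm_self [FiniteDimensional ℝ E] (θ : (p : N) → TangentSpace 𝓘(ℝ, E) p →ₗ[ℝ] F)
    (p : N) (w : E) : chartForm θ p (extChartAt 𝓘(ℝ, E) p p) w = θ p w := by
  have h := chartForm_apply θ (mem_extChartAt_source p) w
  rwa [chartDeriv_self] at h

lemma mpullbackWithin_eq_chartField (X : (p : N) → TangentSpace 𝓘(ℝ, E) p) {p : N} {x : E}
    (hx : x ∈ (extChartAt 𝓘(ℝ, E) p).target) :
    (VectorField.mpullbackWithin 𝓘(ℝ, E) 𝓘(ℝ, E) (extChartAt 𝓘(ℝ, E) p).symm X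
      (Set.range 𝓘(ℝ, E)) x : E) = chartField X p x :=
  congrArg (fun L : E →L[ℝ] E => L (X ((extChartAt 𝓘(ℝ, E) p).symm x) : E))
    (ContinuousLinearMap.inverse_eq
      (mfderivWithin_extChartAt_symm_comp_mfderiv_extChartAt (I := 𝓘(ℝ, E)) hx)
      (mfderiv_extChartAt_comp_mfderivWithin_extChartAt_symm (I := 𝓘(ℝ, E)) hx))

lemma mpullbackWithin_eventuallyEq_chartField (X : (p : N) → TangentSpace 𝓘(ℝ, E) p) (p : N) :
    (VectorField.mpullbackWithin 𝓘(ℝ, E) 𝓘(ℝ, E) (extChartAt 𝓘(ℝ, E) p).symm X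
      (Set.range 𝓘(ℝ, E)) : E → E) =ᶠ[𝓝 (extChartAt 𝓘(ℝ, E) p p)] chartField X p := by
  filter_upwards [extChartAt_target_mem_nhds_self p] with x hx
  exact mpullbackWithin_eq_chartField X hx

lemma mlieBracket_eq_lieBracket_chartField (X Y : (p : N) → TangentSpace 𝓘(ℝ, E) p) (p : N) :
    (VectorField.mlieBracket 𝓘(ℝ, E) X Y p : E) =
      VectorField.lieBracket ℝ (chartField X p) (chartField Y p) (extChartAt 𝓘(ℝ, E) p p) := by
  rw [← (mpullbackWithin_eventuallyEq_chartField X p).lieBracket_vectorField_eq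
    (mpullbackWithin_eventuallyEq_chartField Y p)]
  have hinv : (mfderiv 𝓘(ℝ, E) 𝓘(ℝ, E) (extChartAt 𝓘(ℝ, E) p) p).inverse
      = ContinuousLinearMap.id ℝ E :=
    (congrArg ContinuousLinearMap.inverse (chartDeriv_self (E := E) p)).trans
      ContinuousLinearMap.inverse_id
  have hset : (extChartAt 𝓘(ℝ, E) p).symm ⁻¹' Set.univ ∩ Set.range 𝓘(ℝ, E) = Set.univ := by simp
  refine (congrArg (fun L : E →L[ℝ] E => L _) hinv).trans ?_
  exact (congrArg (fun s => VectorField.lieBracketWithin ℝ (E := E) _ _ s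
    (extChartAt 𝓘(ℝ, E) p p)) hset).trans (congrFun VectorField.lieBracketWithin_univ _)

lemma differentiableAt_chartField [FiniteDimensional ℝ E]
    {X : (p : N) → TangentSpace 𝓘(ℝ, E) p} {p : N}
    (hX : MDifferentiableAt 𝓘(ℝ, E) (𝓘(ℝ, E).prod 𝓘(ℝ, E))
      (fun x => (⟨x, X x⟩ : TangentBundle 𝓘(ℝ, E) N)) p) :
    DifferentiableAt ℝ (chartField X p) (extChartAt 𝓘(ℝ, E) p p) := by
  have h : DifferentiableWithinAt ℝ (E := E) (F := E) _ _ _ :=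
    (mdifferentiableWithinAt_univ.2 hX).differentiableWithinAt_mpullbackWithin_vectorField
  have hset : (extChartAt 𝓘(ℝ, E) p).symm ⁻¹' Set.univ ∩ Set.range 𝓘(ℝ, E) = Set.univ := by simp
  rw [hset] at h
  exact (differentiableWithinAt_univ.1 h).congr_of_eventuallyEq
    (mpullbackWithin_eventuallyEq_chartField X p).symm

lemma smoothFieldOn_chartSymmDeriv (p : N) (w : E) :
    SmoothFieldOn (fun q => (chartSymmDeriv p (extChartAt 𝓘(ℝ, E) p q) w : E))
      (chartAt E p).source := by
  set t := trivializationAt E (TangentSpace 𝓘(ℝ, E) : N → Type _) p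
  have hbase : t.baseSet = (chartAt E p).source := TangentBundle.trivializationAt_baseSet p
  rw [← hbase]
  refine (t.contMDiffOn_section_baseSet_iff (n := ∞) (s := fun q =>
    (show TangentSpace 𝓘(ℝ, E) q from chartSymmDeriv p (extChartAt 𝓘(ℝ, E) p q) w))).2
    ((contMDiffOn_const (c := w)).congr fun q hq => ?_)
  have hsymm : (show TangentSpace 𝓘(ℝ, E) q from
      chartSymmDeriv p (extChartAt 𝓘(ℝ, E) p q) w) = t.symm q w :=
    (congrArg (fun L : E →L[ℝ] TangentSpace 𝓘(ℝ, E) q => L w)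
      (TangentBundle.symmL_trivializationAt (I := 𝓘(ℝ, E)) (hbase ▸ hq)).symm).trans
      (t.symmL_apply hq w)
  exact (congrArg (fun v : TangentSpace 𝓘(ℝ, E) q => (t ⟨q, v⟩).2) hsymm).trans
    (congrArg Prod.snd (t.apply_mk_symm hq w))

lemma IsSmoothForm.differentiableAt_chartForm [FiniteDimensional ℝ E]
    {θ : (p : N) → TangentSpace 𝓘(ℝ, E) p →ₗ[ℝ] F} (hθ : IsSmoothForm θ) (p : N) :
    DifferentiableAt ℝ (chartForm θ p) (extChartAt 𝓘(ℝ, E) p p) := by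
  have hsmooth : ContDiffOn ℝ ∞ (chartForm θ p) (extChartAt 𝓘(ℝ, E) p).target := by
    refine contDiffOn_clm_apply.2 fun w => ?_
    have hcomp := ((hθ _ (chartAt E p).open_source _ (smoothFieldOn_chartSymmDeriv p w)).comp
      (contMDiffOn_extChartAt_symm (n := ∞) (I := 𝓘(ℝ, E)) p)
      (t := (chartAt E p).source) (fun x hx => by
        simpa only [extChartAt_source, Set.mem_preimage] using
          (extChartAt 𝓘(ℝ, E) p).map_target hx)).contDiffOn
    refine hcomp.congr fun x hx => ?_
    simp only [Function.comp_apply]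
    rw [(extChartAt 𝓘(ℝ, E) p).right_inv hx]
    rfl
  exact (hsmooth.contDiffAt (extChartAt_target_mem_nhds_self p)).differentiableAt (by simp)

omit [IsManifold 𝓘(ℝ, E) ∞ N]

variable [IsManifold 𝓘(ℝ, E) 1 N]

lemma hasMFDerivAt_of_eq_comp_chart {f : N → F} {D : E → F} {p : N}
    (hf : f =ᶠ[𝓝 p] D ∘ extChartAt 𝓘(ℝ, E) p)
    (hD : DifferentiableAt ℝ D (extChartAt 𝓘(ℝ, E) p p)) :
    HasMFDerivAt 𝓘(ℝ, E) 𝓘(ℝ, F) f p (fderiv ℝ D (extChartAt 𝓘(ℝ, E) p p) : E →L[ℝ] F) := by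
  have hchart : HasMFDerivAt 𝓘(ℝ, E) 𝓘(ℝ, E) (extChartAt 𝓘(ℝ, E) p) p
      (ContinuousLinearMap.id ℝ E) := by
    have h := (mdifferentiableAt_extChartAt (I := 𝓘(ℝ, E)) (mem_chart_source E p)).hasMFDerivAt
    rwa [mfderiv_extChartAt_self] at h
  exact (hD.hasFDerivAt.hasMFDerivAt.comp p hchart).congr_of_eventuallyEq hf

lemma hasMFDerivAt_extChartAt_symm_self (p : N) :
    HasMFDerivAt 𝓘(ℝ, E) 𝓘(ℝ, E) (extChartAt 𝓘(ℝ, E) p).symm (extChartAt 𝓘(ℝ, E) p p)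
      (ContinuousLinearMap.id ℝ E) := by
  have h := (mdifferentiableWithinAt_extChartAt_symm (I := 𝓘(ℝ, E))
    (mem_extChartAt_target p)).hasMFDerivWithinAt
  rw [mfderivWithin_range_extChartAt_symm] at h
  simp only [modelWithCornersSelf_coe, Set.range_id] at h
  exact hasMFDerivWithinAt_univ.1 h

lemma hasFDerivAt_writtenInCharts {E' : Type*} [NormedAddCommGroup E'] [NormedSpace ℝ E']
    {N' : Type*} [TopologicalSpace N'] [ChartedSpace E' N'] [IsManifold 𝓘(ℝ, E') 1 N']
    {f : N → N'} {p : N} {p' : N'} (hf : MDifferentiableAt 𝓘(ℝ, E) 𝓘(ℝ, E') f p)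
    (hp' : f p ∈ (extChartAt 𝓘(ℝ, E') p').source) :
    HasFDerivAt (fun x => extChartAt 𝓘(ℝ, E') p' (f ((extChartAt 𝓘(ℝ, E) p).symm x)))
      ((chartDeriv (E := E') p' (f p)).comp (modelDeriv E E' f p)) (extChartAt 𝓘(ℝ, E) p p) := by
  rw [extChartAt_source] at hp'
  have hcomp : HasMFDerivAt 𝓘(ℝ, E) 𝓘(ℝ, E') (extChartAt 𝓘(ℝ, E') p' ∘ f) p
      ((chartDeriv (E := E') p' (f p)).comp (modelDeriv E E' f p)) :=
    (mdifferentiableAt_extChartAt (I := 𝓘(ℝ, E')) hp').hasMFDerivAt.comp p hf.hasMFDerivAt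
  have hcongr : ∀ q, q = p → HasMFDerivAt 𝓘(ℝ, E) 𝓘(ℝ, E') (extChartAt 𝓘(ℝ, E') p' ∘ f) q
      ((chartDeriv (E := E') p' (f p)).comp (modelDeriv E E' f p)) := by
    rintro _ rfl
    exact hcomp
  exact ((hcongr _ (extChartAt_to_inv p)).comp _ (hasMFDerivAt_extChartAt_symm_self p)).hasFDerivAt

end Chart

section PullbackAct

variable {E : Type*} [NormedAddCommGroup E] [NormedSpace ℝ E]
  {E' : Type*} [NormedAddCommGroup E'] [NormedSpace ℝ E']
  {F : Type*} [NormedAddCommGroup F] [NormedSpace ℝ F]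
  {P G : Type*} [TopologicalSpace P] [ChartedSpace E P] [TopologicalSpace G] [ChartedSpace E' G]

/-- A family `g ↦ (q ↦ act q g)` of maps of a manifold, read in the charts at `p` and `e`. -/
def actInCharts (act : P → G → P) (p : P) (e : G) (z : E × E') : E :=
  extChartAt 𝓘(ℝ, E) p
    (act ((extChartAt 𝓘(ℝ, E) p).symm z.1) ((extChartAt 𝓘(ℝ, E') e).symm z.2))

lemma eventually_actInCharts_eq_self {act : P → G → P} {e : G} (hid : ∀ p, act p e = p) (p : P) :
    ∀ᶠ x in 𝓝 (extChartAt 𝓘(ℝ, E) p p),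
      actInCharts act p e (x, extChartAt 𝓘(ℝ, E') e e) = x := by
  filter_upwards [extChartAt_target_mem_nhds_self p] with x hx
  rw [actInCharts, extChartAt_to_inv, hid, (extChartAt 𝓘(ℝ, E) p).right_inv hx]

variable [IsManifold 𝓘(ℝ, E) ∞ P] {act : P → G → P}
  (hact : ContMDiff (𝓘(ℝ, E).prod 𝓘(ℝ, E')) 𝓘(ℝ, E) ∞ (fun z : P × G => act z.1 z.2))

include hact

lemma contDiffAt_actInCharts [IsManifold 𝓘(ℝ, E') ∞ G] {p : P} {e : G} (hpe : act p e = p) :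
    ContDiffAt ℝ ∞ (actInCharts (E := E) (E' := E') act p e)
      (extChartAt 𝓘(ℝ, E) p p, extChartAt 𝓘(ℝ, E') e e) := by
  set z₀ : E × E' := (extChartAt 𝓘(ℝ, E) p p, extChartAt 𝓘(ℝ, E') e e)
  have hfst : ContMDiffAt 𝓘(ℝ, E × E') 𝓘(ℝ, E) ∞
      (fun z : E × E' => (extChartAt 𝓘(ℝ, E) p).symm z.1) z₀ :=
    ((contMDiffOn_extChartAt_symm p).contMDiffAt (extChartAt_target_mem_nhds_self p)).comp
      z₀ (contDiff_fst.contMDiff.contMDiffAt (x := z₀))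
  have hsnd : ContMDiffAt 𝓘(ℝ, E × E') 𝓘(ℝ, E') ∞
      (fun z : E × E' => (extChartAt 𝓘(ℝ, E') e).symm z.2) z₀ :=
    ((contMDiffOn_extChartAt_symm e).contMDiffAt (extChartAt_target_mem_nhds_self e)).comp
      z₀ (contDiff_snd.contMDiff.contMDiffAt (x := z₀))
  have hchart : ContMDiffAt 𝓘(ℝ, E) 𝓘(ℝ, E) ∞ (extChartAt 𝓘(ℝ, E) p)
      (act ((extChartAt 𝓘(ℝ, E) p).symm z₀.1) ((extChartAt 𝓘(ℝ, E') e).symm z₀.2)) := by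
    rw [extChartAt_to_inv, extChartAt_to_inv, hpe]
    exact contMDiffAt_extChartAt
  exact (hchart.comp z₀ (hact.contMDiffAt.comp z₀ (hfst.prodMk hsnd))).contDiffAt

lemma fderiv_actInCharts_left {p : P} {e g : G} (hg : g ∈ (extChartAt 𝓘(ℝ, E') e).source)
    (hpg : act p g ∈ (extChartAt 𝓘(ℝ, E) p).source) (w : E) :
    fderiv ℝ (fun x => actInCharts act p e (x, extChartAt 𝓘(ℝ, E') e g))
        (extChartAt 𝓘(ℝ, E) p p) w
      = chartDeriv p (act p g) (modelDeriv E E (fun q => act q g) p w) := by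
  have hsmooth : ContMDiff 𝓘(ℝ, E) 𝓘(ℝ, E) ∞ (fun q => act q g) :=
    hact.comp (contMDiff_id.prodMk contMDiff_const)
  simp only [actInCharts, (extChartAt 𝓘(ℝ, E') e).left_inv hg]
  rw [(hasFDerivAt_writtenInCharts (hsmooth.mdifferentiableAt (by simp)) hpg).fderiv]
  rfl

lemma fderiv_actInCharts_right [IsManifold 𝓘(ℝ, E') 1 G] {p : P} {e : G}
    (hid : ∀ p, act p e = p) {x : E} (hx : x ∈ (extChartAt 𝓘(ℝ, E) p).target) (ξ : E') :
    fderiv ℝ (fun z => actInCharts act p e (x, z)) (extChartAt 𝓘(ℝ, E') e e) ξ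
      = chartField (fun q => modelDeriv E' E (fun g => act q g) e ξ) p x := by
  have hsmooth : ContMDiff 𝓘(ℝ, E') 𝓘(ℝ, E) ∞ (fun g => act ((extChartAt 𝓘(ℝ, E) p).symm x) g) :=
    hact.comp (contMDiff_const.prodMk contMDiff_id)
  have hmem : act ((extChartAt 𝓘(ℝ, E) p).symm x) e ∈ (extChartAt 𝓘(ℝ, E) p).source := by
    rw [hid]
    exact (extChartAt 𝓘(ℝ, E) p).map_target hx
  simp only [actInCharts]
  rw [(hasFDerivAt_writtenInCharts (hsmooth.mdifferentiableAt (by simp)) hmem).fderiv, hid]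
  rfl

lemma eventuallyEq_pullback_act_chart [FiniteDimensional ℝ E] {p : P} {e : G} (hpe : act p e = p)
    (θ : (p : P) → TangentSpace 𝓘(ℝ, E) p →ₗ[ℝ] F) (w : E) :
    (fun g => θ (act p g) (modelDeriv E E (fun q => act q g) p w)) =ᶠ[𝓝 e]
      (fun z => chartForm θ p (actInCharts act p e (extChartAt 𝓘(ℝ, E) p p, z))
        (fderiv ℝ (fun x => actInCharts act p e (x, z)) (extChartAt 𝓘(ℝ, E) p p) w))
      ∘ extChartAt 𝓘(ℝ, E') e := by
  have hcont : Continuous (fun g => act p g) :=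
    hact.continuous.comp (continuous_const.prodMk continuous_id)
  have hsrc : ∀ᶠ g in 𝓝 e, act p g ∈ (extChartAt 𝓘(ℝ, E) p).source := by
    refine hcont.continuousAt.eventually_mem ?_
    rw [hpe]
    exact extChartAt_source_mem_nhds p
  filter_upwards [hsrc, extChartAt_source_mem_nhds (I := 𝓘(ℝ, E')) e] with g hpg hg
  rw [Function.comp_apply, fderiv_actInCharts_left hact hg hpg, actInCharts, extChartAt_to_inv,
    (extChartAt 𝓘(ℝ, E') e).left_inv hg]
  exact (chartForm_apply θ hpg _).symm

/-- Cartan's formula: `d/dg (R_g^* θ) (Y) = (L_V θ) (Y) = V · θ(Y) - θ([V, Y])` at `g = e`, with `V`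
the fundamental vector field of `ξ`. -/
theorem modelDeriv_pullback_act [IsManifold 𝓘(ℝ, E') ∞ G] [FiniteDimensional ℝ E] {e : G}
    (hid : ∀ p, act p e = p) {θ : (p : P) → TangentSpace 𝓘(ℝ, E) p →ₗ[ℝ] F} (hθ : IsSmoothForm θ)
    {Y : (p : P) → TangentSpace 𝓘(ℝ, E) p} {p : P}
    (hY : MDifferentiableAt 𝓘(ℝ, E) (𝓘(ℝ, E).prod 𝓘(ℝ, E))
      (fun x => (⟨x, Y x⟩ : TangentBundle 𝓘(ℝ, E) P)) p) (ξ : E') :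
    modelDeriv E' F (fun g => θ (act p g) (modelDeriv E E (fun q => act q g) p (Y p))) e ξ =
      modelDeriv E F (fun q => θ q (Y q)) p (modelDeriv E' E (fun g => act p g) e ξ) -
      θ p (VectorField.mlieBracket 𝓘(ℝ, E)
        (fun q => modelDeriv E' E (fun g => act q g) e ξ) Y p) := by
  set V : (q : P) → TangentSpace 𝓘(ℝ, E) q := fun q => modelDeriv E' E (fun g => act q g) e ξ
  have hΦ := (contDiffAt_actInCharts hact (hid p)).of_le (m := 2) ENat.LEInfty.out
  have hfix := eventually_actInCharts_eq_self (E := E) (E' := E') hid p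
  have hθp := hθ.differentiableAt_chartForm p
  have hYp := differentiableAt_chartField hY
  have hV : (fun x => fderiv ℝ (fun z => actInCharts (E := E) act p e (x, z))
        (extChartAt 𝓘(ℝ, E') e e) ξ) =ᶠ[𝓝 (extChartAt 𝓘(ℝ, E) p p)] chartField V p := by
    filter_upwards [extChartAt_target_mem_nhds_self p] with x hx
    exact fderiv_actInCharts_right hact hid hx ξ
  have hθY : (fun q => θ q (Y q)) =ᶠ[𝓝 p]
      (fun x => chartForm θ p x (chartField Y p x)) ∘ extChartAt 𝓘(ℝ, E) p := by
    filter_upwards [extChartAt_source_mem_nhds (I := 𝓘(ℝ, E)) p] with q hq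
    rw [Function.comp_apply, chartField_apply Y hq]
    exact (chartForm_apply θ hq _).symm
  have hleft : modelDeriv E' F
      (fun g => θ (act p g) (modelDeriv E E (fun q => act q g) p (Y p))) e = _ :=
    (hasMFDerivAt_of_eq_comp_chart (eventuallyEq_pullback_act_chart hact (hid p) θ (Y p))
      (hasFDerivAt_pullback_family hΦ hfix hθp _).differentiableAt).mfderiv
  have hright : modelDeriv E F (fun q => θ q (Y q)) p = _ :=
    (hasMFDerivAt_of_eq_comp_chart hθY (hθp.clm_apply hYp)).mfderiv
  have hfamily := fderiv_pullback_family hΦ hfix hθp hYp ξ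
  rw [chartField_self Y p] at hfamily
  rw [hleft, hright, hfamily, hV.eq_of_nhds, chartField_self V, chartForm_self,
    hV.lieBracket_vectorField_eq .rfl, ← mlieBracket_eq_lieBracket_chartField]

end PullbackAct

section TangentMaps

variable {EQ HQ : Type*} [NormedAddCommGroup EQ] [NormedSpace ℝ EQ] [TopologicalSpace HQ]
  {IQ : ModelWithCorners ℝ EQ HQ} {Q : Type*} [TopologicalSpace Q] [ChartedSpace HQ Q]
  {E₁ H₁ : Type*} [NormedAddCommGroup E₁] [NormedSpace ℝ E₁] [TopologicalSpace H₁]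
  {I₁ : ModelWithCorners ℝ E₁ H₁} {N₁ : Type*} [TopologicalSpace N₁] [ChartedSpace H₁ N₁]
  [IsManifold I₁ 1 N₁]
  {E₂ H₂ : Type*} [NormedAddCommGroup E₂] [NormedSpace ℝ E₂] [TopologicalSpace H₂]
  {I₂ : ModelWithCorners ℝ E₂ H₂} {N₂ : Type*} [TopologicalSpace N₂] [ChartedSpace H₂ N₂]
  [IsManifold I₂ 1 N₂]
  {E₃ H₃ : Type*} [NormedAddCommGroup E₃] [NormedSpace ℝ E₃] [TopologicalSpace H₃]
  {I₃ : ModelWithCorners ℝ E₃ H₃} {N₃ : Type*} [TopologicalSpace N₃] [ChartedSpace H₃ N₃]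
  [IsManifold I₃ 1 N₃]

lemma contMDiffOn_mfderiv_comp {f : N₁ → N₂} {U : Set N₁} (hU : IsOpen U)
    (hf : ContMDiffOn I₁ I₂ ∞ f U) {s : Set Q} {b : Q → N₁} {v : (q : Q) → TangentSpace I₁ (b q)}
    (hv : ContMDiffOn IQ I₁.tangent ∞ (fun q => (⟨b q, v q⟩ : TangentBundle I₁ N₁)) s)
    (hb : ∀ q ∈ s, b q ∈ U) :
    ContMDiffOn IQ I₂.tangent ∞
      (fun q => (⟨f (b q), mfderiv I₁ I₂ f (b q) (v q)⟩ : TangentBundle I₂ N₂)) s := by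
  refine ((hf.contMDiffOn_tangentMapWithin (m := ∞) (by simp) hU.uniqueMDiffOn).comp hv
    (fun q hq => hb q hq)).congr fun q hq => ?_
  simp only [Function.comp_apply, tangentMapWithin, mfderivWithin_of_isOpen hU (hb q hq)]

lemma contMDiffOn_mfderiv_comp_prod {f : N₁ × N₂ → N₃} {U : Set (N₁ × N₂)} (hU : IsOpen U)
    (hf : ContMDiffOn (I₁.prod I₂) I₃ ∞ f U) {s : Set Q}
    {b₁ : Q → N₁} {v₁ : (q : Q) → TangentSpace I₁ (b₁ q)}
    {b₂ : Q → N₂} {v₂ : (q : Q) → TangentSpace I₂ (b₂ q)}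
    (h₁ : ContMDiffOn IQ I₁.tangent ∞ (fun q => (⟨b₁ q, v₁ q⟩ : TangentBundle I₁ N₁)) s)
    (h₂ : ContMDiffOn IQ I₂.tangent ∞ (fun q => (⟨b₂ q, v₂ q⟩ : TangentBundle I₂ N₂)) s)
    (hb : ∀ q ∈ s, (b₁ q, b₂ q) ∈ U) :
    ContMDiffOn IQ I₃.tangent ∞
      (fun q => (⟨f (b₁ q, b₂ q), mfderiv I₁ I₃ (fun x => f (x, b₂ q)) (b₁ q) (v₁ q) +
        mfderiv I₂ I₃ (fun y => f (b₁ q, y)) (b₂ q) (v₂ q)⟩ : TangentBundle I₃ N₃)) s := by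
  have hpair : ContMDiffOn IQ (I₁.prod I₂).tangent ∞
      (fun q => (⟨(b₁ q, b₂ q), (v₁ q, v₂ q)⟩ : TangentBundle (I₁.prod I₂) (N₁ × N₂))) s :=
    (contMDiff_equivTangentBundleProd_symm (n := ∞)).comp_contMDiffOn (h₁.prodMk h₂)
  refine (contMDiffOn_mfderiv_comp hU hf hpair hb).congr fun q hq => ?_
  have hadd := mfderiv_prod_eq_add_apply (I := I₁) (I' := I₂) (I'' := I₃) (f := f)
    (p := (b₁ q, b₂ q)) (v := (v₁ q, v₂ q))
    ((hf.contMDiffAt (hU.mem_nhds (hb q hq))).mdifferentiableAt (by simp))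
  exact congrArg (Bundle.TotalSpace.mk' E₃ (f (b₁ q, b₂ q))) hadd.symm

end TangentMaps

section ConstantBase

variable {E : Type*} [NormedAddCommGroup E] [NormedSpace ℝ E]
  {N : Type*} [TopologicalSpace N] [ChartedSpace E N]
  {EQ : Type*} [NormedAddCommGroup EQ] [NormedSpace ℝ EQ]
  {HQ : Type*} [TopologicalSpace HQ] {IQ : ModelWithCorners ℝ EQ HQ}
  {Q : Type*} [TopologicalSpace Q] [ChartedSpace HQ Q]

lemma tangentBundle_mk_congr {n n' : N} (h : n = n') {v v' : E} (hv : v = v') :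
    (⟨n, v⟩ : TangentBundle 𝓘(ℝ, E) N) = ⟨n', v'⟩ := by
  subst h hv
  rfl

variable [IsManifold 𝓘(ℝ, E) 1 N]

lemma trivializationAt_self_snd (n : N) (v : E) :
    (trivializationAt E (TangentSpace 𝓘(ℝ, E)) n (⟨n, v⟩ : TangentBundle 𝓘(ℝ, E) N)).2 = v := by
  rw [TangentBundle.trivializationAt_apply]
  exact tangentCoordChange_self (I := 𝓘(ℝ, E)) (mem_extChartAt_source n)

lemma contMDiffOn_tangent_const_iff {s : Set Q} (n : N) (v : Q → E) :
    ContMDiffOn IQ (𝓘(ℝ, E).prod 𝓘(ℝ, E)) ∞ (fun q => (⟨n, v q⟩ : TangentBundle 𝓘(ℝ, E) N)) s ↔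
      ContMDiffOn IQ 𝓘(ℝ, E) ∞ v s := by
  refine forall₂_congr fun q _ => ?_
  rw [Bundle.contMDiffWithinAt_totalSpace]
  have hsnd : (fun q => (trivializationAt E (TangentSpace 𝓘(ℝ, E)) n
      (⟨n, v q⟩ : TangentBundle 𝓘(ℝ, E) N)).2) = v :=
    funext fun q => trivializationAt_self_snd n (v q)
  exact ⟨fun h => hsnd ▸ h.2, fun h => ⟨contMDiffWithinAt_const, hsnd.symm ▸ h⟩⟩

end ConstantBase

section Adjoint

variable {EG : Type*} [NormedAddCommGroup EG] [NormedSpace ℝ EG]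
  {G : Type*} [TopologicalSpace G] [ChartedSpace EG G] [Group G]
  {EQ : Type*} [NormedAddCommGroup EQ] [NormedSpace ℝ EQ]
  {HQ : Type*} [TopologicalSpace HQ] {IQ : ModelWithCorners ℝ EQ HQ}
  {Q : Type*} [TopologicalSpace Q] [ChartedSpace HQ Q]

lemma Ad_one (ξ : LieAlg EG G) : Ad (1 : G) ξ = ξ :=
  modelDeriv_of_eventually_eq_self (E₁ := EG) (.of_forall fun k => by simp) ξ

variable (EG) in
/-- The left Maurer–Cartan form `T_g G → 𝔤`, the derivative at `g` of the translation by `g⁻¹`. -/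
def maurerCartan (g : G) : TangentSpace 𝓘(ℝ, EG) g →ₗ[ℝ] EG :=
  (modelDeriv EG EG (fun h => g⁻¹ * h) g).toLinearMap

lemma mulInvariantVectorField_one (η : LieAlg EG G) :
    mulInvariantVectorField (I := 𝓘(ℝ, EG)) η (1 : G) = η :=
  modelDeriv_of_eventually_eq_self (E₁ := EG) (.of_forall fun k => by simp) η

lemma maurerCartan_one (η : LieAlg EG G) : maurerCartan EG (1 : G) η = η :=
  modelDeriv_of_eventually_eq_self (E₁ := EG) (.of_forall fun k => by simp) η

variable [LieGroup 𝓘(ℝ, EG) ∞ G]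

lemma mdifferentiableAt_mul_left (g h : G) :
    MDifferentiableAt 𝓘(ℝ, EG) 𝓘(ℝ, EG) (fun k : G => g * k) h :=
  (contMDiff_mul_left (I := 𝓘(ℝ, EG)) (n := ∞)).mdifferentiableAt (by simp)

lemma mdifferentiableAt_mul_right (g h : G) :
    MDifferentiableAt 𝓘(ℝ, EG) 𝓘(ℝ, EG) (fun k : G => k * g) h :=
  (contMDiff_mul_right (I := 𝓘(ℝ, EG)) (n := ∞)).mdifferentiableAt (by simp)

lemma contMDiff_conj : ContMDiff (𝓘(ℝ, EG).prod 𝓘(ℝ, EG)) 𝓘(ℝ, EG) ∞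
    (fun z : G × G => z.1 * z.2 * z.1⁻¹) :=
  (contMDiff_fst.mul contMDiff_snd).mul contMDiff_fst.inv

lemma mdifferentiableAt_conj (g h : G) :
    MDifferentiableAt 𝓘(ℝ, EG) 𝓘(ℝ, EG) (fun h : G => g * h * g⁻¹) h :=
  ((contMDiff_conj (EG := EG) (G := G)).comp
    (contMDiff_const.prodMk contMDiff_id)).mdifferentiableAt (by simp)

lemma Ad_mul (g h : G) (ξ : LieAlg EG G) : Ad (g * h) ξ = Ad g (Ad h ξ) :=
  modelDeriv_comp (E₁ := EG) (E₂ := EG) (E₃ := EG) (g := fun k : G => g * k * g⁻¹)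
    (f := fun k : G => h * k * h⁻¹) (.of_forall fun k => by group) (by simp)
    (mdifferentiableAt_conj g 1) (mdifferentiableAt_conj h 1) ξ

lemma contMDiffOn_Ad {s : Set Q} {k : Q → G} {γ : Q → LieAlg EG G}
    (hk : ContMDiffOn IQ 𝓘(ℝ, EG) ∞ k s) (hγ : ContMDiffOn IQ 𝓘(ℝ, EG) ∞ (M' := EG) γ s) :
    ContMDiffOn IQ 𝓘(ℝ, EG) ∞ (M' := EG) (fun q => Ad (k q) (γ q)) s := by
  replace hγ := (contMDiffOn_tangent_const_iff (E := EG) (1 : G) γ).2 hγ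
  refine (contMDiffOn_tangent_const_iff (E := EG) (1 : G) _).1 ?_
  have hzero : ContMDiffOn IQ (𝓘(ℝ, EG).prod 𝓘(ℝ, EG)) ∞
      (fun q => (⟨k q, 0⟩ : TangentBundle 𝓘(ℝ, EG) G)) s :=
    (Bundle.contMDiff_zeroSection ℝ (TangentSpace 𝓘(ℝ, EG) : G → Type _)).comp_contMDiffOn hk
  refine (contMDiffOn_mfderiv_comp_prod isOpen_univ (contMDiff_conj (G := G)).contMDiffOn hzero hγ
    (fun _ _ => Set.mem_univ _)).congr fun q _ => ?_
  refine tangentBundle_mk_congr (by simp) ?_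
  rw [map_zero, zero_add]
  rfl

lemma isSmoothForm_maurerCartan : IsSmoothForm (maurerCartan EG (G := G)) := by
  intro W _ X hX
  refine (contMDiffOn_tangent_const_iff (E := EG) (1 : G) _).1 ?_
  have hzero : ContMDiffOn 𝓘(ℝ, EG) (𝓘(ℝ, EG).prod 𝓘(ℝ, EG)) ∞
      (fun g => (⟨g⁻¹, 0⟩ : TangentBundle 𝓘(ℝ, EG) G)) W :=
    (Bundle.contMDiff_zeroSection ℝ (TangentSpace 𝓘(ℝ, EG) : G → Type _)).comp_contMDiffOn
      (contMDiff_inv 𝓘(ℝ, EG) ∞).contMDiffOn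
  refine (contMDiffOn_mfderiv_comp_prod isOpen_univ
    (contMDiff_mul (G := G) 𝓘(ℝ, EG) ∞).contMDiffOn hzero hX
    (fun _ _ => Set.mem_univ _)).congr fun q _ => ?_
  refine tangentBundle_mk_congr (by simp) ?_
  rw [map_zero, zero_add]
  rfl

lemma maurerCartan_mulInvariantVectorField (g : G) (η : LieAlg EG G) :
    maurerCartan EG g (mulInvariantVectorField (I := 𝓘(ℝ, EG)) η g) = η := by
  have hcomp := modelDeriv_comp (E₁ := EG) (E₂ := EG) (E₃ := EG) (h := fun k : G => k)
    (g := fun k : G => g⁻¹ * k) (f := fun k : G => g * k) (p := 1)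
    (.of_forall fun k => by simp) (mul_one g)
    (mdifferentiableAt_mul_left _ _) (mdifferentiableAt_mul_left _ _) η
  exact hcomp.symm.trans
    (modelDeriv_of_eventually_eq_self (E₁ := EG) (.of_forall fun _ => rfl) η)

lemma maurerCartan_modelDeriv_mul_right (g : G) (η : LieAlg EG G) :
    maurerCartan EG (1 * g) (modelDeriv EG EG (fun k : G => k * g) 1 η) = Ad g⁻¹ η :=
  (modelDeriv_comp (E₁ := EG) (E₂ := EG) (E₃ := EG)
    (g := fun k : G => (1 * g)⁻¹ * k) (f := fun k : G => k * g)
    (.of_forall fun k => by group) rfl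
    (mdifferentiableAt_mul_left _ _) (mdifferentiableAt_mul_right _ _) η).symm

/-- Cartan's formula for the Maurer–Cartan form and a left-invariant field: right translation acts
on the former by `Ad g⁻¹`, and its value on the latter is constant. -/
theorem modelDeriv_Ad_inv [FiniteDimensional ℝ EG] (ξ η : LieAlg EG G) :
    modelDeriv EG EG (N₂ := EG) (fun g : G => (Ad g⁻¹ η : LieAlg EG G)) 1 ξ = -⁅ξ, η⁆ := by
  have hcartan := modelDeriv_pullback_act (act := fun g h : G => g * h)
    (contMDiff_mul 𝓘(ℝ, EG) ∞) mul_one isSmoothForm_maurerCartan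
    (mdifferentiableAt_mulInvariantVectorField (I := 𝓘(ℝ, EG)) η (g := (1 : G))) ξ
  have hconst : modelDeriv EG EG (N₂ := EG) (fun _ : G => η) 1 = 0 :=
    mfderiv_const (I := 𝓘(ℝ, EG)) (I' := 𝓘(ℝ, EG))
  simp only [mulInvariantVectorField_one, maurerCartan_mulInvariantVectorField] at hcartan
  rw [funext fun g : G => maurerCartan_modelDeriv_mul_right g η, hconst] at hcartan
  rw [hcartan, zero_apply, zero_sub]
  exact congrArg Neg.neg (maurerCartan_one _)

end Adjoint

section ModelDerivProd

variable {E E₁ E₂ E₃ : Type*} [NormedAddCommGroup E] [NormedSpace ℝ E]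
  [NormedAddCommGroup E₁] [NormedSpace ℝ E₁] [NormedAddCommGroup E₂] [NormedSpace ℝ E₂]
  [NormedAddCommGroup E₃] [NormedSpace ℝ E₃]
  {N N₁ N₂ N₃ : Type*} [TopologicalSpace N] [ChartedSpace E N]
  [TopologicalSpace N₁] [ChartedSpace E₁ N₁] [TopologicalSpace N₂] [ChartedSpace E₂ N₂]
  [TopologicalSpace N₃] [ChartedSpace E₃ N₃]

lemma modelDeriv_comp_prodMk {f : N₁ × N₂ → N₃} {f₁ : N → N₁} {f₂ : N → N₂} {p : N}
    {a : N₁} {b : N₂} (ha : f₁ p = a) (hb : f₂ p = b)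
    (hf : MDifferentiableAt (𝓘(ℝ, E₁).prod 𝓘(ℝ, E₂)) 𝓘(ℝ, E₃) f (a, b))
    (h₁ : MDifferentiableAt 𝓘(ℝ, E) 𝓘(ℝ, E₁) f₁ p)
    (h₂ : MDifferentiableAt 𝓘(ℝ, E) 𝓘(ℝ, E₂) f₂ p) (v : E) :
    modelDeriv E E₃ (fun q => f (f₁ q, f₂ q)) p v =
      modelDeriv E₁ E₃ (fun x => f (x, b)) a (modelDeriv E E₁ f₁ p v) +
        modelDeriv E₂ E₃ (fun y => f (a, y)) b (modelDeriv E E₂ f₂ p v) := by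
  subst ha hb
  have hcomp := (hf.hasMFDerivAt.comp p (h₁.hasMFDerivAt.prodMk h₂.hasMFDerivAt)).mfderiv
  refine (congrArg (fun L : E →L[ℝ] E₃ => L v) hcomp).trans ?_
  exact mfderiv_prod_eq_add_apply (I := 𝓘(ℝ, E₁)) (I' := 𝓘(ℝ, E₂)) (I'' := 𝓘(ℝ, E₃)) (f := f)
    (p := (f₁ p, f₂ p)) (v := (modelDeriv E E₁ f₁ p v, modelDeriv E E₂ f₂ p v)) hf

end ModelDerivProd

section BundleGeometry

variable {EM EP EG : Type*}
  [NormedAddCommGroup EM] [NormedSpace ℝ EM] [NormedAddCommGroup EP] [NormedSpace ℝ EP]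
  [NormedAddCommGroup EG] [NormedSpace ℝ EG]
  {M P G : Type*} [TopologicalSpace M] [ChartedSpace EM M]
  [TopologicalSpace P] [ChartedSpace EP P]
  [TopologicalSpace G] [ChartedSpace EG G] [Group G]

namespace PrincipalBundle

variable (B : PrincipalBundle EM EP EG M P G)

lemma exists_triv (x : M) : ∃ φ : B.Triv, x ∈ φ.baseSet := B.exists_localTriv x

lemma mdifferentiableAt_act_left (g : G) (p : P) :
    MDifferentiableAt 𝓘(ℝ, EP) 𝓘(ℝ, EP) (fun p => B.act p g) p :=
  (B.smooth_act.comp (contMDiff_id.prodMk contMDiff_const)).mdifferentiableAt (by simp)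

lemma mdifferentiableAt_act_right (p : P) (g : G) :
    MDifferentiableAt 𝓘(ℝ, EG) 𝓘(ℝ, EP) (fun g => B.act p g) g :=
  (B.smooth_act.comp (contMDiff_const.prodMk contMDiff_id)).mdifferentiableAt (by simp)

lemma modelDeriv_act_one (p : P) (w : EP) : modelDeriv EP EP (fun p => B.act p 1) p w = w :=
  modelDeriv_of_eventually_eq_self (.of_forall B.act_one) w

lemma modelDeriv_act_mul (g h : G) {p p' : P} (hp : B.act p g = p') (w : EP) :
    modelDeriv EP EP (fun p => B.act p (g * h)) p w =
      modelDeriv EP EP (fun p => B.act p h) p' (modelDeriv EP EP (fun p => B.act p g) p w) :=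
  modelDeriv_comp (.of_forall fun q => B.act_mul q g h) hp
    (B.mdifferentiableAt_act_left h p') (B.mdifferentiableAt_act_left g p) w

lemma tangentAct_surjective (g : G) (p : P) : Function.Surjective (tangentAct B g p) := by
  intro (u : EP)
  have hmul := B.modelDeriv_act_mul g⁻¹ g (p := B.act p g) (p' := p)
    (by rw [← B.act_mul, mul_inv_cancel, B.act_one]) u
  rw [inv_mul_cancel, B.modelDeriv_act_one] at hmul
  exact ⟨_, hmul.symm⟩

lemma fundamental_neg (p : P) (ξ : LieAlg EG G) :
    fundamental B p (-ξ) = -fundamental B p ξ :=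
  map_neg (modelDeriv EG EP (fun g : G => B.act p g) 1) ξ

lemma fundamental_act [LieGroup 𝓘(ℝ, EG) ∞ G] (p : P) (g : G) (ξ : LieAlg EG G) :
    fundamental B (B.act p g) (Ad g⁻¹ ξ) = tangentAct B g p (fundamental B p ξ) := by
  have hconj := modelDeriv_comp (E₁ := EG) (E₂ := EG) (E₃ := EP) (p := (1 : G)) (q := 1)
    (h := fun k : G => B.act (B.act p k) g)
    (g := fun k : G => B.act (B.act p g) k) (f := fun k : G => g⁻¹ * k * g⁻¹⁻¹)
    (.of_forall fun k => by
      rw [← B.act_mul, ← B.act_mul]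
      exact congrArg (B.act p) (by group)) (by simp) (B.mdifferentiableAt_act_right _ _)
    (mdifferentiableAt_conj _ _) ξ
  have htrans := modelDeriv_comp (E₁ := EG) (E₂ := EP) (E₃ := EP) (p := (1 : G)) (q := p)
    (h := fun k : G => B.act (B.act p k) g)
    (g := fun q => B.act q g) (f := fun k : G => B.act p k)
    (.of_forall fun k => rfl) (B.act_one p) (B.mdifferentiableAt_act_left _ _)
    (B.mdifferentiableAt_act_right _ _) ξ
  exact hconj.symm.trans htrans

lemma smoothFieldOn_fundamental [IsManifold 𝓘(ℝ, EP) ∞ P] [LieGroup 𝓘(ℝ, EG) ∞ G] {s : Set P}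
    {v : P → LieAlg EG G} (hv : ContMDiffOn 𝓘(ℝ, EP) 𝓘(ℝ, EG) ∞ (M' := EG) v s) :
    SmoothFieldOn (fun p => fundamental B p (v p)) s := by
  replace hv := (contMDiffOn_tangent_const_iff (E := EG) (1 : G) v).2 hv
  have hzero : ContMDiffOn 𝓘(ℝ, EP) (𝓘(ℝ, EP).prod 𝓘(ℝ, EP)) ∞
      (fun p => (⟨p, 0⟩ : TangentBundle 𝓘(ℝ, EP) P)) s :=
    (Bundle.contMDiff_zeroSection ℝ (TangentSpace 𝓘(ℝ, EP) : P → Type _)).contMDiffOn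
  refine (contMDiffOn_mfderiv_comp_prod isOpen_univ B.smooth_act.contMDiffOn hzero hv
    (fun _ _ => Set.mem_univ _)).congr fun q _ => ?_
  refine tangentBundle_mk_congr (B.act_one q).symm ?_
  rw [map_zero, zero_add]
  rfl

end PrincipalBundle

variable {B : PrincipalBundle EM EP EG M P G}

namespace LocalTriv

section Section

variable (φ : B.Triv)

lemma mem_target {x : M} (hx : x ∈ φ.baseSet) (g : G) : (x, g) ∈ φ.toHomeo.target := by
  rw [φ.target_eq]
  exact ⟨hx, Set.mem_univ _⟩

lemma mem_source {p : P} (hp : B.proj p ∈ φ.baseSet) : p ∈ φ.toHomeo.source := by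
  rwa [φ.source_eq]

lemma toHomeo_sec {x : M} (hx : x ∈ φ.baseSet) : φ.toHomeo (φ.sec x) = (x, 1) :=
  φ.toHomeo.right_inv (φ.mem_target hx 1)

lemma proj_sec {x : M} (hx : x ∈ φ.baseSet) : B.proj (φ.sec x) = x := by
  have hsource : φ.sec x ∈ φ.toHomeo.source := φ.toHomeo.map_target (φ.mem_target hx 1)
  rw [← φ.fst_eq _ hsource, φ.toHomeo_sec hx]

lemma proj_sec_mem {x : M} (hx : x ∈ φ.baseSet) : B.proj (φ.sec x) ∈ φ.baseSet := by
  rwa [φ.proj_sec hx]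

lemma toHomeo_act_snd {p : P} (hp : B.proj p ∈ φ.baseSet) (g : G) :
    (φ.toHomeo (B.act p g)).2 = (φ.toHomeo p).2 * g :=
  φ.snd_act p (φ.mem_source hp) g

lemma toHomeo_symm_eq_act_sec {x : M} (hx : x ∈ φ.baseSet) (g : G) :
    φ.toHomeo.symm (x, g) = B.act (φ.sec x) g := by
  have hmem : B.proj (B.act (φ.sec x) g) ∈ φ.baseSet := by
    rw [B.proj_act]
    exact φ.proj_sec_mem hx
  have himage : φ.toHomeo (B.act (φ.sec x) g) = (x, g) := by
    refine Prod.ext ?_ ?_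
    · rw [φ.fst_eq _ (φ.mem_source hmem), B.proj_act, φ.proj_sec hx]
    · rw [φ.toHomeo_act_snd (φ.proj_sec_mem hx), φ.toHomeo_sec hx, one_mul]
  rw [← himage, φ.toHomeo.left_inv (φ.mem_source hmem)]

lemma act_sec_proj {p : P} (hp : B.proj p ∈ φ.baseSet) :
    B.act (φ.sec (B.proj p)) (φ.toHomeo p).2 = p := by
  rw [← φ.toHomeo_symm_eq_act_sec hp, ← φ.fst_eq p (φ.mem_source hp)]
  exact φ.toHomeo.left_inv (φ.mem_source hp)

lemma exists_act_sec_eq {p : P} (hp : B.proj p ∈ φ.baseSet) :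
    ∃ x ∈ φ.baseSet, ∃ g, B.act (φ.sec x) g = p :=
  ⟨_, hp, _, φ.act_sec_proj hp⟩

lemma isOpen_preimage_baseSet : IsOpen (B.proj ⁻¹' φ.baseSet) :=
  φ.isOpen_baseSet.preimage B.smooth_proj.continuous

lemma contMDiffOn_sec : ContMDiffOn 𝓘(ℝ, EM) 𝓘(ℝ, EP) ∞ φ.sec φ.baseSet :=
  φ.smooth_invFun.comp (contMDiff_id.prodMk contMDiff_const).contMDiffOn
    (fun _ hx => φ.mem_target hx 1)

lemma contMDiffOn_sec_field [IsManifold 𝓘(ℝ, EP) ∞ P]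
    {X : (p : P) → TangentSpace 𝓘(ℝ, EP) p}
    (hX : SmoothFieldOn X Set.univ) :
    ContMDiffOn 𝓘(ℝ, EM) (𝓘(ℝ, EP).prod 𝓘(ℝ, EP)) ∞
      (fun x => (⟨φ.sec x, X (φ.sec x)⟩ : TangentBundle 𝓘(ℝ, EP) P)) φ.baseSet :=
  ContMDiffOn.comp (t := Set.univ) hX φ.contMDiffOn_sec fun _ _ => Set.mem_univ _

lemma mdifferentiableAt_sec {x : M} (hx : x ∈ φ.baseSet) :
    MDifferentiableAt 𝓘(ℝ, EM) 𝓘(ℝ, EP) φ.sec x :=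
  (φ.contMDiffOn_sec.contMDiffAt (φ.isOpen_baseSet.mem_nhds hx)).mdifferentiableAt (by simp)

lemma contMDiffOn_toHomeo_snd : ContMDiffOn 𝓘(ℝ, EP) 𝓘(ℝ, EG) ∞ (fun p => (φ.toHomeo p).2)
    (B.proj ⁻¹' φ.baseSet) := by
  rw [← φ.source_eq]
  exact contMDiff_snd.comp_contMDiffOn φ.smooth_toFun

/-- The component along `G` of a tangent vector at `s(x)`, that is the derivative of
`s(y) · g ↦ g`. -/
def verticalPart (x : M) (u : EP) : LieAlg EG G :=
  modelDeriv EP EG (fun p => (φ.toHomeo p).2) (φ.sec x) u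

lemma mfderiv_sec_add_fundamental_verticalPart {x : M} (hx : x ∈ φ.baseSet) (u : EP) :
    (mfderiv 𝓘(ℝ, EM) 𝓘(ℝ, EP) φ.sec x (modelDeriv EP EM B.proj (φ.sec x) u) : EP) +
      fundamental B (φ.sec x) (φ.verticalPart x u) = u := by
  have hproj : MDifferentiableAt 𝓘(ℝ, EP) 𝓘(ℝ, EM) B.proj (φ.sec x) :=
    B.smooth_proj.mdifferentiableAt (by simp)
  have hnhds := φ.isOpen_preimage_baseSet.mem_nhds (φ.proj_sec_mem hx)
  have hadd := modelDeriv_comp_prodMk (E := EP) (E₁ := EP) (E₂ := EG) (E₃ := EP)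
    (f := fun z : P × G => B.act z.1 z.2) (f₁ := fun q => φ.sec (B.proj q))
    (f₂ := fun q => (φ.toHomeo q).2) (p := φ.sec x) (by rw [φ.proj_sec hx])
    (by rw [φ.toHomeo_sec hx]) (B.smooth_act.mdifferentiableAt (by simp))
    ((φ.mdifferentiableAt_sec (φ.proj_sec_mem hx)).comp _ hproj)
    ((φ.contMDiffOn_toHomeo_snd.contMDiffAt hnhds).mdifferentiableAt (by simp)) u
  have hself : modelDeriv EP EP (fun q => B.act (φ.sec (B.proj q)) (φ.toHomeo q).2)
      (φ.sec x) u = u :=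
    modelDeriv_of_eventually_eq_self (Filter.eventually_of_mem hnhds fun _ => φ.act_sec_proj) u
  have hsec : modelDeriv EP EP (fun q => φ.sec (B.proj q)) (φ.sec x) u =
      modelDeriv EM EP φ.sec x (modelDeriv EP EM B.proj (φ.sec x) u) :=
    modelDeriv_comp (f := B.proj) (g := φ.sec) (.of_forall fun _ => rfl) (φ.proj_sec hx)
      (φ.mdifferentiableAt_sec hx) hproj u
  rw [hself, B.modelDeriv_act_one, hsec] at hadd
  exact hadd.symm

lemma nablaZero_sec (X : (x : M) → TangentSpace 𝓘(ℝ, EM) x) {x : M} (hx : x ∈ φ.baseSet) :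
    φ.nablaZero X (φ.sec x) = mfderiv 𝓘(ℝ, EM) 𝓘(ℝ, EP) φ.sec x (X x) := by
  have hgen : ∀ y, y = x → ∀ g : G, g = 1 →
      modelDeriv EP EP (fun p => B.act p g) (φ.sec y) (modelDeriv EM EP φ.sec y (X y)) =
        modelDeriv EM EP φ.sec x (X x) := by
    rintro _ rfl _ rfl
    exact B.modelDeriv_act_one _ _
  exact hgen _ (φ.proj_sec hx) _ (by rw [φ.toHomeo_sec hx])

lemma tangentAct_nablaZero (X : (x : M) → TangentSpace 𝓘(ℝ, EM) x) {p : P}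
    (hp : B.proj p ∈ φ.baseSet) (g : G) :
    tangentAct B g p (φ.nablaZero X p) = φ.nablaZero X (B.act p g) := by
  have hgen : ∀ y, y = B.proj p → ∀ k : G, k = (φ.toHomeo p).2 * g →
      modelDeriv EP EP (fun p => B.act p k) (φ.sec y) (modelDeriv EM EP φ.sec y (X y)) =
        tangentAct B g p (φ.nablaZero X p) := by
    rintro _ rfl _ rfl
    exact B.modelDeriv_act_mul _ _ (φ.act_sec_proj hp) _
  exact (hgen _ (B.proj_act p g) _ (φ.toHomeo_act_snd hp g)).symm

lemma Psi_sec (γ : M → LieAlg EG G) {x : M} (hx : x ∈ φ.baseSet) :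
    φ.Psi γ (φ.sec x) = γ x := by
  rw [Psi, φ.toHomeo_sec hx, φ.proj_sec hx, inv_one, Ad_one]

lemma Psi_act [LieGroup 𝓘(ℝ, EG) ∞ G] (γ : M → LieAlg EG G) {p : P}
    (hp : B.proj p ∈ φ.baseSet) (g : G) : φ.Psi γ (B.act p g) = Ad g⁻¹ (φ.Psi γ p) := by
  rw [Psi, Psi, φ.toHomeo_act_snd hp, B.proj_act, mul_inv_rev, Ad_mul]

lemma contMDiffOn_Psi [LieGroup 𝓘(ℝ, EG) ∞ G] {γ : M → LieAlg EG G}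
    (hγ : ContMDiffOn 𝓘(ℝ, EM) 𝓘(ℝ, EG) ∞ (M' := EG) γ φ.baseSet) :
    ContMDiffOn 𝓘(ℝ, EP) 𝓘(ℝ, EG) ∞ (M' := EG) (φ.Psi γ) (B.proj ⁻¹' φ.baseSet) :=
  contMDiffOn_Ad φ.contMDiffOn_toHomeo_snd.inv
    (hγ.comp B.smooth_proj.contMDiffOn fun _ hp => hp)

end Section

section InvariantLift

variable [IsManifold 𝓘(ℝ, EM) ∞ M] (φ : B.Triv)

lemma S_sec (Y : TLASection EM EG G φ.baseSet) {x : M} (hx : x ∈ φ.baseSet) :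
    φ.S Y (φ.sec x) =
      mfderiv 𝓘(ℝ, EM) 𝓘(ℝ, EP) φ.sec x (Y.vec x) - fundamental B (φ.sec x) (Y.alg x) := by
  rw [S, φ.nablaZero_sec Y.vec hx, iota, φ.Psi_sec Y.alg hx, sub_eq_add_neg]

lemma S_sec_eq_of_val_eq (Y : TLASection EM EG G φ.baseSet) {x : M} (hx : x ∈ φ.baseSet)
    {u : EP} (hY : Y.val x = (modelDeriv EP EM B.proj (φ.sec x) u, -φ.verticalPart x u)) :
    φ.S Y (φ.sec x) = u := by
  rw [φ.S_sec Y hx, show Y.vec x = _ from congrArg Prod.fst hY,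
    show Y.alg x = _ from congrArg Prod.snd hY, B.fundamental_neg, sub_neg_eq_add]
  exact φ.mfderiv_sec_add_fundamental_verticalPart hx u

variable [LieGroup 𝓘(ℝ, EG) ∞ G]

lemma tangentAct_S (Y : TLASection EM EG G φ.baseSet) {p : P} (hp : B.proj p ∈ φ.baseSet)
    (g : G) : tangentAct B g p (φ.S Y p) = φ.S Y (B.act p g) := by
  rw [S, map_add, φ.tangentAct_nablaZero Y.vec hp, iota, map_neg, ← B.fundamental_act,
    ← φ.Psi_act Y.alg hp]
  rfl

variable [IsManifold 𝓘(ℝ, EP) ∞ P]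

lemma smoothFieldOn_nablaZero {W : Set M} (hW : W ⊆ φ.baseSet)
    {X : (x : M) → TangentSpace 𝓘(ℝ, EM) x} (hX : SmoothFieldOn X W) :
    SmoothFieldOn (φ.nablaZero X) (B.proj ⁻¹' W) := by
  have hbase : ContMDiffOn 𝓘(ℝ, EP) (𝓘(ℝ, EM).prod 𝓘(ℝ, EM)) ∞
      (fun p => (⟨B.proj p, X (B.proj p)⟩ : TangentBundle 𝓘(ℝ, EM) M)) (B.proj ⁻¹' W) :=
    ContMDiffOn.comp (t := W) hX B.smooth_proj.contMDiffOn (fun _ hp => hp)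
  have hsec := contMDiffOn_mfderiv_comp φ.isOpen_baseSet φ.contMDiffOn_sec hbase
    (fun _ hp => hW hp)
  have hzero : ContMDiffOn 𝓘(ℝ, EP) (𝓘(ℝ, EG).prod 𝓘(ℝ, EG)) ∞
      (fun p => (⟨(φ.toHomeo p).2, 0⟩ : TangentBundle 𝓘(ℝ, EG) G)) (B.proj ⁻¹' W) :=
    (Bundle.contMDiff_zeroSection ℝ (TangentSpace 𝓘(ℝ, EG) : G → Type _)).comp_contMDiffOn
      (φ.contMDiffOn_toHomeo_snd.mono fun _ hp => hW hp)
  refine (contMDiffOn_mfderiv_comp_prod isOpen_univ B.smooth_act.contMDiffOn hsec hzero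
    (fun _ _ => Set.mem_univ _)).congr fun p hp => ?_
  refine tangentBundle_mk_congr (φ.act_sec_proj (hW hp)).symm ?_
  rw [map_zero, add_zero]
  rfl

lemma smoothFieldOn_S (Y : TLASection EM EG G φ.baseSet) :
    SmoothFieldOn (φ.S Y) (B.proj ⁻¹' φ.baseSet) :=
  ContMDiffOn.add_section (φ.smoothFieldOn_nablaZero subset_rfl Y.smooth_vec)
    (ContMDiffOn.neg_section (B.smoothFieldOn_fundamental (φ.contMDiffOn_Psi Y.smooth_alg)))

/-- The section of `TLA(U, 𝔤)` that the isomorphism `S` sends to an invariant vector field. -/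
def toTLASection (X : InvariantField B) : TLASection EM EG G φ.baseSet where
  vec x := (modelDeriv EP EM B.proj (φ.sec x) (X.val (φ.sec x)) : EM)
  alg x := -φ.verticalPart x (X.val (φ.sec x))
  smooth_vec := (contMDiffOn_mfderiv_comp isOpen_univ B.smooth_proj.contMDiffOn
    (φ.contMDiffOn_sec_field X.2.1) (fun _ _ => Set.mem_univ _)).congr
      fun x hx => tangentBundle_mk_congr (φ.proj_sec hx).symm rfl
  smooth_alg := by
    refine (contMDiffOn_tangent_const_iff (E := EG) (1 : G) _).1 ?_
    have hneg : SmoothFieldOn (fun p => -X.val p) (Set.univ : Set P) :=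
      ContMDiffOn.neg_section X.2.1
    refine (contMDiffOn_mfderiv_comp φ.isOpen_preimage_baseSet φ.contMDiffOn_toHomeo_snd
      (φ.contMDiffOn_sec_field hneg) (fun _ hx => φ.proj_sec_mem hx)).congr fun x hx => ?_
    refine tangentBundle_mk_congr (by rw [φ.toHomeo_sec hx]) ?_
    exact (map_neg (modelDeriv EP EG (fun p => (φ.toHomeo p).2) (φ.sec x)) _).symm

lemma S_toTLASection (X : InvariantField B) {p : P} (hp : B.proj p ∈ φ.baseSet) :
    φ.S (φ.toTLASection X) p = X.val p := by
  obtain ⟨x, hx, g, rfl⟩ := φ.exists_act_sec_eq hp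
  rw [← φ.tangentAct_S _ (φ.proj_sec_mem hx),
    φ.S_sec_eq_of_val_eq _ hx (u := X.val (φ.sec x)) rfl]
  exact X.2.2 g (φ.sec x)

variable {V : Type*} [NormedAddCommGroup V] [NormedSpace ℝ V]

theorem smoothOn_pullback {q : ℕ} {β : TLAForm EP P EG G V q} (hβ : β.SmoothOn Set.univ) :
    (β.pullback φ).SmoothOn φ.baseSet := by
  intro W hW hWU Y
  let Y' : Fin q → TLASection EP EG G (B.proj ⁻¹' W) := fun k =>
    ⟨φ.nablaZero (Y k).vec, fun p => (Y k).alg (B.proj p),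
      φ.smoothFieldOn_nablaZero hWU (Y k).smooth_vec,
      (Y k).smooth_alg.comp B.smooth_proj.contMDiffOn fun _ hp => hp⟩
  have hsmooth := (hβ _ (hW.preimage B.smooth_proj.continuous) (Set.subset_univ _) Y').comp
    (φ.contMDiffOn_sec.mono hWU) fun x hx => by
      rwa [Set.mem_preimage, Set.mem_preimage, φ.proj_sec (hWU hx)]
  refine hsmooth.congr fun x hx => congrArg (β (φ.sec x)) (funext fun k => Prod.ext ?_ ?_)
  · exact (φ.nablaZero_sec (Y k).vec (hWU hx)).symm
  · exact congrArg (Y k).alg (φ.proj_sec (hWU hx)).symm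

end InvariantLift

end LocalTriv

end BundleGeometry

section CutOff

variable {E N : Type*} [NormedAddCommGroup E] [NormedSpace ℝ E] [TopologicalSpace N]
  [ChartedSpace E N] [IsManifold 𝓘(ℝ, E) ∞ N]

lemma SmoothFieldOn.smul_of_tsupport_subset {f : N → ℝ} {W : Set N}
    {X : (x : N) → TangentSpace 𝓘(ℝ, E) x} (hX : SmoothFieldOn X W) (hW : IsOpen W)
    (hf : ContMDiff 𝓘(ℝ, E) 𝓘(ℝ, ℝ) ∞ f) (hfW : tsupport f ⊆ W) :
    SmoothFieldOn (fun x => f x • X x) Set.univ :=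
  (ContMDiffOn.smul_section_of_tsupport (s := X) hf.contMDiffOn hW hfW hX).contMDiffOn

variable [FiniteDimensional ℝ E] [T2Space N]

lemma exists_smoothFun_eventually_eq_one {x : N} {W : Set N} (hW : W ∈ 𝓝 x) :
    ∃ f : SmoothFun E N, f =ᶠ[𝓝 x] 1 ∧ tsupport f ⊆ W := by
  obtain ⟨f, -, hf⟩ := (SmoothBumpFunction.nhds_basis_tsupport (I := 𝓘(ℝ, E)) x).mem_iff.1 hW
  exact ⟨⟨f, f.contMDiff⟩, f.eventuallyEq_one, hf⟩

lemma exists_smoothFieldOn_univ_val_eq (x : N) (v : TangentSpace 𝓘(ℝ, E) x) :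
    ∃ X : (y : N) → TangentSpace 𝓘(ℝ, E) y, SmoothFieldOn X Set.univ ∧ X x = v := by
  obtain ⟨W, hW, hv⟩ := FiberBundle.exists_contMDiffOn_extend (k := ∞) 𝓘(ℝ, E) E v
  obtain ⟨f, hf, hfW⟩ := exists_smoothFun_eventually_eq_one (E := E) (interior_mem_nhds.2 hW)
  have hvW : SmoothFieldOn (FiberBundle.extend E v) (interior W) := hv.mono interior_subset
  refine ⟨fun y => f y • FiberBundle.extend E v y,
    hvW.smul_of_tsupport_subset isOpen_interior f.contMDiff hfW, ?_⟩
  change f x • FiberBundle.extend E v x = v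
  rw [hf.self_of_nhds, Pi.one_apply, one_smul, FiberBundle.extend_apply_self]

end CutOff

section Values

variable {EM EP EG : Type*}
  [NormedAddCommGroup EM] [NormedSpace ℝ EM] [NormedAddCommGroup EP] [NormedSpace ℝ EP]
  [NormedAddCommGroup EG] [NormedSpace ℝ EG]
  {M P G : Type*} [TopologicalSpace M] [ChartedSpace EM M]
  [TopologicalSpace P] [ChartedSpace EP P] [IsManifold 𝓘(ℝ, EP) ∞ P]
  [TopologicalSpace G] [ChartedSpace EG G] [Group G]
  {V : Type*} [NormedAddCommGroup V] [NormedSpace ℝ V]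
  {B : PrincipalBundle EM EP EG M P G} {C : Coeff EG G V} {q : ℕ} (α : AtiyahForm B C q)

namespace AtiyahForm

lemma val_smul_of_eq_one {f : SmoothFun EM M} {p : P} (hf : f (B.proj p) = 1)
    (X : Fin q → InvariantField B) : α.val (fun k => f • X k) p = α.val X p := by
  have hsmul : α.val (fun k => f • X k) p = (∏ _k : Fin q, f) (B.proj p) • α.val X p :=
    congrFun (congrArg Subtype.val (α.toMultilinearMap.map_smul_univ (fun _ => f) X)) p
  rw [hsmul, Finset.prod_const, ContMDiffMap.coe_pow, Pi.pow_apply, hf, one_pow, one_smul]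

lemma val_act (X : Fin q → InvariantField B) (p : P) (g : G) :
    α.val X (B.act p g) = C.act g⁻¹ (α.val X p) :=
  (α X).2.2 p g

end AtiyahForm

end Values

section Locality

variable {EM EP EG : Type*}
  [NormedAddCommGroup EM] [NormedSpace ℝ EM] [FiniteDimensional ℝ EM]
  [NormedAddCommGroup EP] [NormedSpace ℝ EP] [NormedAddCommGroup EG] [NormedSpace ℝ EG]
  {M P G : Type*} [TopologicalSpace M] [ChartedSpace EM M] [IsManifold 𝓘(ℝ, EM) ∞ M] [T2Space M]
  [TopologicalSpace P] [ChartedSpace EP P] [IsManifold 𝓘(ℝ, EP) ∞ P]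
  [TopologicalSpace G] [ChartedSpace EG G] [Group G]
  {V : Type*} [NormedAddCommGroup V] [NormedSpace ℝ V]
  {B : PrincipalBundle EM EP EG M P G}

lemma exists_invariantField_eventually_eq {W : Set M} (hW : IsOpen W)
    {Z : (p : P) → TangentSpace 𝓘(ℝ, EP) p} (hZ : SmoothFieldOn Z (B.proj ⁻¹' W))
    (hinv : ∀ p, B.proj p ∈ W → ∀ g, tangentAct B g p (Z p) = Z (B.act p g)) {x : M} (hx : x ∈ W) :
    ∃ X : InvariantField B, ∀ᶠ y in 𝓝 x, ∀ p, B.proj p = y → X.val p = Z p := by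
  obtain ⟨f, hf, hfW⟩ := exists_smoothFun_eventually_eq_one (E := EM) (hW.mem_nhds hx)
  refine ⟨⟨fun p => f (B.proj p) • Z p, ?_, fun g p => ?_⟩, ?_⟩
  · exact hZ.smul_of_tsupport_subset (hW.preimage B.smooth_proj.continuous)
      (f.contMDiff.comp B.smooth_proj)
      ((tsupport_comp_subset_preimage f B.smooth_proj.continuous).trans (Set.preimage_mono hfW))
  · change tangentAct B g p (f (B.proj p) • Z p) = f (B.proj (B.act p g)) • Z (B.act p g)
    rw [map_smul, B.proj_act]
    by_cases hp : B.proj p ∈ W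
    · rw [hinv p hp]
    · rw [image_eq_zero_of_notMem_tsupport fun h => hp (hfW h), zero_smul, zero_smul]
  · filter_upwards [hf] with y hy p hp
    rw [hp, hy, Pi.one_apply, one_smul]

namespace AtiyahForm

variable {C : Coeff EG G V} {q : ℕ} (α : AtiyahForm B C q)

lemma val_congr {X X' : Fin q → InvariantField B} {p : P}
    (h : ∀ᶠ y in 𝓝 (B.proj p), ∀ k p', B.proj p' = y → (X k).val p' = (X' k).val p') :
    α.val X p = α.val X' p := by
  obtain ⟨f, hf, hfW⟩ := exists_smoothFun_eventually_eq_one (E := EM) h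
  have hXX' : (fun k => f • X k) = fun k => f • X' k := by
    refine funext fun k => Subtype.ext (funext fun p' => ?_)
    change f (B.proj p') • (X k).val p' = f (B.proj p') • (X' k).val p'
    by_cases hp' : B.proj p' ∈ tsupport f
    · rw [hfW hp' k p' rfl]
    · rw [image_eq_zero_of_notMem_tsupport hp', zero_smul, zero_smul]
  rw [← α.val_smul_of_eq_one hf.self_of_nhds X, hXX', α.val_smul_of_eq_one hf.self_of_nhds X']

lemma loc_eq_val {φ : B.Triv} {Y : Fin q → TLASection EM EG G φ.baseSet} {x : φ.baseSet}
    {X : Fin q → InvariantField B}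
    (hX : ∀ᶠ y in 𝓝 (x : M), ∀ k p, B.proj p = y → (X k).val p = φ.S (Y k) p) :
    α.loc φ Y x = α.val X (φ.sec x) := by
  have hproj := φ.proj_sec x.2
  have hex : ∃ X : Fin q → InvariantField B, ∃ W ∈ 𝓝 (B.proj (φ.sec x)), ∀ k, ∀ p' : P,
      B.proj p' ∈ W → (X k).val p' = φ.S (Y k) p' := by
    rw [hproj]
    exact ⟨X, _, hX, fun k p' hp' => hp' k p' rfl⟩
  change α.restrict (fun k => φ.S (Y k)) (φ.sec x) = _
  rw [restrict, dif_pos hex]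
  obtain ⟨W, hW, hchoose⟩ := hex.choose_spec
  refine α.val_congr ?_
  rw [← hproj] at hX
  filter_upwards [hW, hX] with y hyW hyX k p' hp'
  rw [hchoose k p' (hp' ▸ hyW), hyX k p' hp']

variable [LieGroup 𝓘(ℝ, EG) ∞ G]

lemma ext_of_loc_eq {α α' : AtiyahForm B C q} (h : ∀ φ : B.Triv, α.loc φ = α'.loc φ) :
    α = α' := by
  refine AlternatingMap.ext fun X => Subtype.ext (funext fun p => ?_)
  obtain ⟨φ, hφ⟩ := B.exists_triv (B.proj p)
  obtain ⟨x, hx, g, rfl⟩ := φ.exists_act_sec_eq hφ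
  have hX : ∀ᶠ y in 𝓝 x, ∀ k p, B.proj p = y →
      (X k).val p = φ.S (φ.toTLASection (X k)) p :=
    Filter.eventually_of_mem (φ.isOpen_baseSet.mem_nhds hx) fun y hy k p hp =>
      (φ.S_toTLASection (X k) (hp ▸ hy)).symm
  have hloc := congrFun (congrFun (h φ) fun k => φ.toTLASection (X k)) ⟨x, hx⟩
  rw [α.loc_eq_val hX, α'.loc_eq_val hX] at hloc
  exact (α.val_act X _ g).trans ((congrArg (C.act g⁻¹) hloc).trans (α'.val_act X _ g).symm)

end AtiyahForm

variable [LieGroup 𝓘(ℝ, EG) ∞ G]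

lemma LocalTriv.exists_invariantField_eventually_eq_S (φ : B.Triv) {ι : Type*} [Finite ι]
    (Y : ι → TLASection EM EG G φ.baseSet) {x : M} (hx : x ∈ φ.baseSet) :
    ∃ X : ι → InvariantField B,
      ∀ᶠ y in 𝓝 x, ∀ k p, B.proj p = y → (X k).val p = φ.S (Y k) p := by
  choose X hX using fun k => exists_invariantField_eventually_eq φ.isOpen_baseSet
    (φ.smoothFieldOn_S (Y k)) (fun _ hp g => φ.tangentAct_S (Y k) hp g) hx
  exact ⟨X, Filter.eventually_all.2 hX⟩

theorem Corresponds.loc_eq_onSections_pullback {C : Coeff EG G V} {q : ℕ} {α : AtiyahForm B C q}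
    {β : TLAForm EP P EG G V q} (h : Corresponds β α) (φ : B.Triv) :
    α.loc φ = (β.pullback φ).onSections := by
  funext Y x
  obtain ⟨X, hX⟩ := φ.exists_invariantField_eventually_eq_S Y x.2
  rw [α.loc_eq_val hX, h X (fun k _ => (Y k).alg x) (fun k => contMDiff_const)]
  refine congrArg (β (φ.sec x)) (funext fun k => Prod.ext ?_ rfl)
  have hS := (hX.self_of_nhds k _ (φ.proj_sec x.2)).trans (φ.S_sec (Y k) x.2)
  change (X k).val (φ.sec x) + fundamental B (φ.sec x) ((Y k).alg x) = _
  rw [hS, sub_add_cancel]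
  rfl

lemma LocalTriv.exists_invariantField_val_sec_eq (φ : B.Triv) {x : M} (hx : x ∈ φ.baseSet)
    (u : EP) : ∃ X : InvariantField B, X.val (φ.sec x) = u := by
  obtain ⟨X, hX, hXx⟩ := exists_smoothFieldOn_univ_val_eq (E := EM) x
    (modelDeriv EP EM B.proj (φ.sec x) u : EM)
  let Y : TLASection EM EG G φ.baseSet :=
    ⟨X, fun _ => -φ.verticalPart x u, hX.mono (Set.subset_univ _), contMDiffOn_const⟩
  obtain ⟨Z, hZ⟩ := φ.exists_invariantField_eventually_eq_S (fun _ : Unit => Y) hx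
  exact ⟨Z (), (hZ.self_of_nhds () _ (φ.proj_sec hx)).trans
    (φ.S_sec_eq_of_val_eq Y hx (Prod.ext hXx rfl))⟩

lemma exists_invariantField_val_eq (p : P) (u : TangentSpace 𝓘(ℝ, EP) p) :
    ∃ X : InvariantField B, X.val p = u := by
  obtain ⟨φ, hφ⟩ := B.exists_triv (B.proj p)
  obtain ⟨x, hx, g, rfl⟩ := φ.exists_act_sec_eq hφ
  obtain ⟨u', rfl⟩ := B.tangentAct_surjective g (φ.sec x) u
  obtain ⟨X, hX⟩ := φ.exists_invariantField_val_sec_eq hx u'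
  exact ⟨X, by rw [← hX]; exact (X.2.2 g (φ.sec x)).symm⟩

theorem Corresponds.unique {C : Coeff EG G V} {q : ℕ} {β β' : TLAForm EP P EG G V q}
    {α : AtiyahForm B C q} (h : Corresponds β α) (h' : Corresponds β' α) : β = β' := by
  refine funext fun p => AlternatingMap.ext fun Y => ?_
  choose X hX using fun k =>
    exists_invariantField_val_eq (B := B) p ((Y k).1 - fundamental B p (Y k).2)
  have hY : (fun k => ((X k).val p + fundamental B p (Y k).2, (Y k).2)) = Y :=
    funext fun k => Prod.ext (by rw [hX, sub_add_cancel]) rfl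
  rw [← hY]
  exact (h X (fun k _ => (Y k).2) (fun k => contMDiff_const) p).symm.trans
    (h' X (fun k _ => (Y k).2) (fun k => contMDiff_const) p)

end Locality

section AlternatingComp

variable {E : Type*} [NormedAddCommGroup E] [NormedSpace ℝ E]
  {N : Type*} [TopologicalSpace N] [ChartedSpace E N]
  {F V : Type*} [NormedAddCommGroup F] [NormedSpace ℝ F] [NormedAddCommGroup V] [NormedSpace ℝ V]
  {ι : Type*} [Fintype ι] (D : F [⋀^ι]→L[ℝ] V) {σ : ι → N → F}

lemma modelDeriv_alternating_comp [DecidableEq ι] {p : N}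
    (hσ : ∀ k, MDifferentiableAt 𝓘(ℝ, E) 𝓘(ℝ, F) (σ k) p) (v : E) :
    modelDeriv E V (fun q => D (fun k => σ k q)) p v =
      ∑ k, D (Function.update (fun j => σ j p) k (modelDeriv E F (σ k) p v)) := by
  have hpi : HasMFDerivAt 𝓘(ℝ, E) 𝓘(ℝ, ι → F) (fun q k => σ k q) p
      (ContinuousLinearMap.pi fun k => modelDeriv E F (σ k) p) :=
    ⟨continuousAt_pi.2 fun k => (hσ k).continuousAt,
      hasFDerivWithinAt_pi.2 fun k => (hσ k).hasMFDerivAt.2⟩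
  have hcomp := ((D.hasFDerivAt (fun k => σ k p)).hasMFDerivAt.comp p hpi).mfderiv
  exact (congrArg (fun L : E →L[ℝ] V => L v) hcomp).trans
    (D.toContinuousMultilinearMap.linearDeriv_apply (fun k => σ k p)
      fun k => modelDeriv E F (σ k) p v)

omit [Fintype ι] in
lemma contMDiffOn_alternating_comp [Finite ι] {s : Set N}
    (hσ : ∀ k, ContMDiffOn 𝓘(ℝ, E) 𝓘(ℝ, F) ∞ (σ k) s) :
    ContMDiffOn 𝓘(ℝ, E) 𝓘(ℝ, V) ∞ (fun q => D (fun k => σ k q)) s := by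
  have := Fintype.ofFinite ι
  exact D.contDiff.contMDiff.comp_contMDiffOn (contMDiffOn_pi_space.2 hσ)

end AlternatingComp

section VanishingDerivative

variable {E : Type*} [NormedAddCommGroup E] [NormedSpace ℝ E]
  {N : Type*} [TopologicalSpace N] [ChartedSpace E N] [IsManifold 𝓘(ℝ, E) ∞ N]
  {F : Type*} [NormedAddCommGroup F] [NormedSpace ℝ F] {f : N → F}

lemma hasFDerivAt_comp_extChartAt_symm_of_modelDeriv_eq_zero
    (hf : ∀ p, MDifferentiableAt 𝓘(ℝ, E) 𝓘(ℝ, F) f p) (hf' : ∀ p, modelDeriv E F f p = 0) {p : N}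
    {x : E} (hx : x ∈ (extChartAt 𝓘(ℝ, E) p).target) :
    HasFDerivAt (f ∘ (extChartAt 𝓘(ℝ, E) p).symm) (0 : E →L[ℝ] F) x := by
  have hchart : MDifferentiableAt 𝓘(ℝ, E) 𝓘(ℝ, E) (extChartAt 𝓘(ℝ, E) p).symm x :=
    ((contMDiffOn_extChartAt_symm (n := ∞) (I := 𝓘(ℝ, E)) p).contMDiffAt
      ((isOpen_extChartAt_target p).mem_nhds hx)).mdifferentiableAt (by simp)
  have hzero : HasMFDerivAt 𝓘(ℝ, E) 𝓘(ℝ, F) f ((extChartAt 𝓘(ℝ, E) p).symm x)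
      (0 : E →L[ℝ] F) := hf' ((extChartAt 𝓘(ℝ, E) p).symm x) ▸ (hf _).hasMFDerivAt
  have hcomp : (0 : E →L[ℝ] F).comp (modelDeriv E E (extChartAt 𝓘(ℝ, E) p).symm x) = 0 :=
    ContinuousLinearMap.zero_comp _
  exact hcomp ▸ (hzero.comp x hchart.hasMFDerivAt).hasFDerivAt

lemma isLocallyConstant_of_modelDeriv_eq_zero
    (hf : ∀ p, MDifferentiableAt 𝓘(ℝ, E) 𝓘(ℝ, F) f p) (hf' : ∀ p, modelDeriv E F f p = 0) :
    IsLocallyConstant f := by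
  refine (IsLocallyConstant.iff_eventually_eq f).2 fun p => ?_
  obtain ⟨r, hr, hball⟩ := Metric.mem_nhds_iff.1 (extChartAt_target_mem_nhds_self (E := E) p)
  have hderiv x (hx : x ∈ Metric.ball (extChartAt 𝓘(ℝ, E) p p) r) :=
    hasFDerivAt_comp_extChartAt_symm_of_modelDeriv_eq_zero hf hf' (hball hx)
  filter_upwards [(continuousAt_extChartAt (I := 𝓘(ℝ, E)) p).preimage_mem_nhds
    (Metric.ball_mem_nhds _ hr), extChartAt_source_mem_nhds (I := 𝓘(ℝ, E)) p] with y hyr hy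
  have hconst := Metric.isOpen_ball.is_const_of_fderiv_eq_zero (𝕜 := ℝ)
    (convex_ball (extChartAt 𝓘(ℝ, E) p p) r).isPreconnected
    (fun x hx => (hderiv x hx).differentiableAt.differentiableWithinAt)
    (fun x hx => (hderiv x hx).fderiv) hyr (Metric.mem_ball_self hr)
  simp only [Function.comp_apply] at hconst
  rwa [(extChartAt 𝓘(ℝ, E) p).left_inv hy, extChartAt_to_inv] at hconst

end VanishingDerivative

section EquivariantForms

variable {EG : Type*} [NormedAddCommGroup EG] [NormedSpace ℝ EG]
  {G : Type*} [TopologicalSpace G] [ChartedSpace EG G] [Group G]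
  {V : Type*} [NormedAddCommGroup V] [NormedSpace ℝ V] {ι : Type*}

/-- Alternating maps on `𝔤` that are `G`-equivariant: these are the elements of `⋀𝔤^* ⊗ V` that can
be evaluated on a connection form to give a form on the Atiyah Lie algebroid. -/
def IsEquivariant (C : Coeff EG G V) (D : LieAlg EG G [⋀^ι]→L[ℝ] V) : Prop :=
  ∀ (g : G) (v : ι → LieAlg EG G), D (fun k => Ad g (v k)) = C.act g (D v)

/-- The infinitesimal counterpart of `IsEquivariant`. -/
def IsInfEquivariant [Fintype ι] [DecidableEq ι] (C : Coeff EG G V)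
    (D : LieAlg EG G [⋀^ι]→L[ℝ] V) : Prop :=
  ∀ (ξ : LieAlg EG G) (v : ι → LieAlg EG G),
    ∑ k, D (Function.update v k ⁅ξ, v k⁆) = C.infAct ξ (D v)

variable [LieGroup 𝓘(ℝ, EG) ∞ G]

lemma contMDiff_Ad_inv (η : LieAlg EG G) :
    ContMDiff 𝓘(ℝ, EG) 𝓘(ℝ, EG) ∞ (M' := EG) (fun g : G => (Ad g⁻¹ η : LieAlg EG G)) :=
  contMDiffOn_univ.1 (contMDiffOn_Ad (contMDiff_inv 𝓘(ℝ, EG) ∞).contMDiffOn contMDiffOn_const)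

variable [Fintype ι] (D : LieAlg EG G [⋀^ι]→L[ℝ] V)

omit [Fintype ι] in
lemma mdifferentiableAt_map_Ad_inv [Finite ι] (v : ι → LieAlg EG G) (g : G) :
    MDifferentiableAt 𝓘(ℝ, EG) 𝓘(ℝ, V) (fun g : G => D (fun k => Ad g⁻¹ (v k))) g :=
  (contMDiffOn_univ.1 (contMDiffOn_alternating_comp (F := EG) D
    (fun k => (contMDiff_Ad_inv (v k)).contMDiffOn))).mdifferentiableAt (by simp)

variable [DecidableEq ι] [FiniteDimensional ℝ EG] {D}

lemma modelDeriv_map_Ad_inv_one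
    (hD : ∀ (ξ : LieAlg EG G) (v : ι → LieAlg EG G), ∑ k, D (Function.update v k ⁅ξ, v k⁆) = 0)
    (v : ι → LieAlg EG G) (ξ : LieAlg EG G) :
    modelDeriv EG V (fun g : G => D (fun k => Ad g⁻¹ (v k))) 1 ξ = 0 := by
  have hderiv := modelDeriv_alternating_comp (F := EG) D
    (fun k => (contMDiff_Ad_inv (v k)).mdifferentiableAt (x := (1 : G)) (by simp)) ξ
  refine hderiv.trans (Eq.trans (Finset.sum_congr rfl fun k _ => ?_)
    ((Finset.sum_neg_distrib _).trans (neg_eq_zero.2 (hD ξ v))))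
  have hone : (fun j => Ad (1 : G)⁻¹ (v j)) = v := by
    funext j; rw [inv_one, Ad_one]
  refine (congrArg₂ (fun (u : ι → LieAlg EG G) w => D (Function.update u k w)) hone
    (modelDeriv_Ad_inv ξ (v k))).trans (D.map_update_neg v k _)

lemma modelDeriv_map_Ad_inv
    (hD : ∀ (ξ : LieAlg EG G) (v : ι → LieAlg EG G), ∑ k, D (Function.update v k ⁅ξ, v k⁆) = 0)
    (v : ι → LieAlg EG G) (g : G) :
    modelDeriv EG V (fun g : G => D (fun k => Ad g⁻¹ (v k))) g = 0 := by
  ext ξ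
  have htranslate (h : G) : D (fun k => Ad h⁻¹ (v k)) =
      D (fun k => Ad (g⁻¹ * h)⁻¹ (Ad g⁻¹ (v k))) := by
    simp only [← Ad_mul, mul_inv_rev, inv_inv, mul_inv_cancel_right]
  exact (modelDeriv_comp (N₂ := G) (E₁ := EG) (E₂ := EG) (E₃ := V) (p := g) (q := 1)
    (g := fun h : G => D (fun k => Ad h⁻¹ (Ad g⁻¹ (v k)))) (f := fun h => g⁻¹ * h)
    (.of_forall htranslate) (inv_mul_cancel g) (mdifferentiableAt_map_Ad_inv D _ 1)
    (mdifferentiableAt_mul_left _ _) ξ).trans (modelDeriv_map_Ad_inv_one hD _ _)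

theorem map_Ad_of_sum_map_update_lie_eq_zero [PreconnectedSpace G]
    (hD : ∀ (ξ : LieAlg EG G) (v : ι → LieAlg EG G), ∑ k, D (Function.update v k ⁅ξ, v k⁆) = 0)
    (g : G) (v : ι → LieAlg EG G) : D (fun k => Ad g (v k)) = D v := by
  have hconst := (isLocallyConstant_of_modelDeriv_eq_zero (mdifferentiableAt_map_Ad_inv D v)
    (modelDeriv_map_Ad_inv hD v)).apply_eq_of_preconnectedSpace g⁻¹ 1
  simpa only [inv_inv, inv_one, Ad_one] using hconst

lemma IsInfEquivariant.isEquivariant_scalar [PreconnectedSpace G] {𝕜 : Type*} [RCLike 𝕜]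
    {D : LieAlg EG G [⋀^ι]→L[ℝ] 𝕜} (hD : IsInfEquivariant (scalar EG G 𝕜) D) :
    IsEquivariant (scalar EG G 𝕜) D :=
  map_Ad_of_sum_map_update_lie_eq_zero hD

end EquivariantForms

section ConnectionForms

variable {EM EP EG : Type*}
  [NormedAddCommGroup EM] [NormedSpace ℝ EM] [NormedAddCommGroup EP] [NormedSpace ℝ EP]
  [NormedAddCommGroup EG] [NormedSpace ℝ EG]
  {M P G : Type*} [TopologicalSpace M] [ChartedSpace EM M]
  [TopologicalSpace P] [ChartedSpace EP P] [IsManifold 𝓘(ℝ, EP) ∞ P]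
  [TopologicalSpace G] [ChartedSpace EG G] [Group G]
  {V : Type*} [NormedAddCommGroup V] [NormedSpace ℝ V]
  {B : PrincipalBundle EM EP EG M P G} (A : Connection B)
  {q : ℕ} (D : LieAlg EG G [⋀^Fin q]→L[ℝ] V)

namespace Connection

/-- The `𝔤`-valued `1`-form `ω_∇ - θ` on `TLA(P, 𝔤)`, where `θ` is the projection to `𝔤`. -/
def tlaForm (p : P) : TLAFiber EP EG G p →ₗ[ℝ] LieAlg EG G :=
  A.form p ∘ₗ LinearMap.fst ℝ (TangentSpace 𝓘(ℝ, EP) p) (LieAlg EG G)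
    - LinearMap.snd ℝ (TangentSpace 𝓘(ℝ, EP) p) (LieAlg EG G)

/-- The form `D(ω_∇ - θ, …, ω_∇ - θ)` on `TLA(P, 𝔤)`. -/
def basicForm : TLAForm EP P EG G V q :=
  fun p => D.toAlternatingMap.compLinearMap (A.tlaForm p)

lemma basicForm_apply (p : P) (Y : Fin q → TLAFiber EP EG G p) :
    A.basicForm D p Y = D (fun k => A.tlaForm p (Y k)) :=
  rfl

lemma tlaForm_fundamental (p : P) (ξ : LieAlg EG G) :
    A.tlaForm p (fundamental B p ξ, ξ) = 0 :=
  sub_eq_zero.2 (A.form_fundamental p ξ)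

lemma isHorizontal_basicForm : IsHorizontal B (A.basicForm D) := fun ξ p k Y hk => by
  rw [basicForm_apply]
  exact D.toAlternatingMap.map_coord_zero k
    ((congrArg (A.tlaForm p) hk).trans (A.tlaForm_fundamental p ξ))

lemma contMDiffOn_tlaForm {W : Set P} (hW : IsOpen W) (Y : TLASection EP EG G W) :
    ContMDiffOn 𝓘(ℝ, EP) 𝓘(ℝ, EG) ∞ (M' := EG) (fun p => A.tlaForm p (Y.val p)) W :=
  ContMDiffOn.sub (A.smooth_form W hW Y.vec Y.smooth_vec) Y.smooth_alg

lemma smoothOn_basicForm : (A.basicForm D).SmoothOn Set.univ := fun _ hW _ Y =>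
  contMDiffOn_alternating_comp (F := EG) D fun k => A.contMDiffOn_tlaForm hW (Y k)

variable {D}

/-- The form `D(ω_∇, …, ω_∇)` on the Atiyah Lie algebroid. -/
def atiyahForm {C : Coeff EG G V} (hD : IsEquivariant C D) : AtiyahForm B C q where
  toFun X := ⟨fun p => D (fun k => A.form p ((X k).val p)),
    contMDiffOn_univ.1 (contMDiffOn_alternating_comp (F := EG) D fun k =>
      A.smooth_form Set.univ isOpen_univ _ (X k).2.1), fun p g => by
    rw [← hD]
    refine congrArg D (funext fun k => ?_)
    exact (congrArg (A.form _) ((X k).2.2 g p).symm).trans (A.form_act g p _)⟩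
  map_update_add' {inst} X k Y Z := by
    obtain rfl : inst = instDecidableEqFin q := Subsingleton.elim _ _
    refine Subtype.ext (funext fun p => ?_)
    have hupdate (Y : InvariantField B) := funext fun j =>
      Function.apply_update (fun _ (Y : InvariantField B) => A.form p (Y.val p)) X k Y j
    change D _ = D _ + D _
    rw [hupdate, hupdate, hupdate, ← D.map_update_add]
    exact congrArg (fun w => D (Function.update _ k w)) ((A.form p).map_add _ _)
  map_update_smul' {inst} X k f Y := by
    obtain rfl : inst = instDecidableEqFin q := Subsingleton.elim _ _
    refine Subtype.ext (funext fun p => ?_)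
    have hupdate (Y : InvariantField B) := funext fun j =>
      Function.apply_update (fun _ (Y : InvariantField B) => A.form p (Y.val p)) X k Y j
    change D _ = f (B.proj p) • D _
    rw [hupdate, hupdate, ← D.map_update_smul]
    exact congrArg (fun w => D (Function.update _ k w)) ((A.form p).map_smul _ _)
  map_eq_zero_of_eq' X i j hij hne := Subtype.ext (funext fun p =>
    D.map_eq_zero_of_eq _ (by rw [hij]) hne)

lemma atiyahForm_val {C : Coeff EG G V} (hD : IsEquivariant C D) (X : Fin q → InvariantField B)
    (p : P) : (A.atiyahForm hD).val X p = D (fun k => A.form p ((X k).val p)) :=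
  rfl

theorem corresponds_basicForm {C : Coeff EG G V} (hD : IsEquivariant C D) :
    Corresponds (A.basicForm D) (A.atiyahForm hD) := fun X v _ p => by
  rw [atiyahForm_val, basicForm_apply]
  refine congrArg D (funext fun k => ?_)
  have htla : A.tlaForm p ((X k).val p + fundamental B p (v k p), v k p) =
      A.form p ((X k).val p + fundamental B p (v k p)) - v k p := rfl
  rw [htla, map_add, A.form_fundamental, add_sub_cancel_right]

variable [FiniteDimensional ℝ EP] [FiniteDimensional ℝ EG] [LieGroup 𝓘(ℝ, EG) ∞ G]

/-- The infinitesimal version of `R_g^* ω_∇ = Ad_{g⁻¹} ω_∇`. -/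
lemma lieDeriv_form (ξ : LieAlg EG G) {Y : (p : P) → TangentSpace 𝓘(ℝ, EP) p}
    (hY : SmoothFieldOn Y Set.univ) (p : P) :
    (modelDeriv EP EG (N₂ := EG) (fun q => A.form q (Y q)) p (fundamental B p ξ) : LieAlg EG G) =
      A.form p (VectorField.mlieBracket 𝓘(ℝ, EP) (fun q => fundamental B q ξ) Y p) -
        ⁅ξ, A.form p (Y p)⁆ := by
  have hpullback := modelDeriv_pullback_act (E := EP) (E' := EG) (F := EG) B.smooth_act B.act_one
    (θ := A.form) A.smooth_form ((contMDiffOn_univ.1 hY).mdifferentiableAt (x := p) (by simp)) ξ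
  have hact : (fun g : G => A.form (B.act p g) (tangentAct B g p (Y p))) =
      fun g => Ad g⁻¹ (A.form p (Y p)) := funext fun g => A.form_act g p (Y p)
  have hAd := modelDeriv_Ad_inv ξ (A.form p (Y p))
  rw [← hact] at hAd
  have hsub := hpullback.symm.trans hAd
  exact (sub_eq_iff_eq_add.1 hsub).trans (neg_add_eq_sub _ _)

lemma lieDeriv_tlaForm (ξ : LieAlg EG G) (Y : TLASection EP EG G (Set.univ : Set P)) (p : P) :
    (modelDeriv EP EG (N₂ := EG) (fun q => A.tlaForm q (Y.val q)) p (fundamental B p ξ) :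
      LieAlg EG G) =
      A.tlaForm p (tlaBracket (fun q => fundamental B q ξ) Y.vec (fun _ => ξ) Y.alg p) -
        ⁅ξ, A.tlaForm p (Y.val p)⁆ := by
  have hform : MDifferentiableAt 𝓘(ℝ, EP) 𝓘(ℝ, EG) (M' := EG) (fun q => A.form q (Y.vec q)) p :=
    (contMDiffOn_univ.1 (A.smooth_form _ isOpen_univ Y.vec Y.smooth_vec)).mdifferentiableAt
      (by simp)
  have halg : MDifferentiableAt 𝓘(ℝ, EP) 𝓘(ℝ, EG) (M' := EG) Y.alg p :=
    (contMDiffOn_univ.1 Y.smooth_alg).mdifferentiableAt (by simp)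
  let dform : LieAlg EG G :=
    modelDeriv EP EG (N₂ := EG) (fun q => A.form q (Y.vec q)) p (fundamental B p ξ)
  let dalg : LieAlg EG G := modelDeriv EP EG (N₂ := EG) Y.alg p (fundamental B p ξ)
  have hderiv : modelDeriv EP EG (N₂ := EG) (fun q => A.tlaForm q (Y.val q)) p
      (fundamental B p ξ) = dform - dalg :=
    congrArg (fun L : EP →L[ℝ] EG => L (fundamental B p ξ))
      (hform.hasMFDerivAt.sub halg.hasMFDerivAt).mfderiv
  have hconst : modelDeriv EP EG (N₂ := EG) (fun _ : P => (ξ : EG)) p (Y.vec p) = 0 :=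
    congrArg (fun L : EP →L[ℝ] EG => L (Y.vec p)) mfderiv_const
  have hbracket : A.tlaForm p
      (tlaBracket (fun q => fundamental B q ξ) Y.vec (fun _ => ξ) Y.alg p) =
      A.form p (VectorField.mlieBracket 𝓘(ℝ, EP) (fun q => fundamental B q ξ) Y.vec p) -
        (dalg - 0 + ⁅ξ, Y.alg p⁆) :=
    congrArg (fun w : LieAlg EG G => A.form p (VectorField.mlieBracket 𝓘(ℝ, EP)
      (fun q => fundamental B q ξ) Y.vec p) - (dalg - w + ⁅ξ, Y.alg p⁆)) hconst
  have hlie : ⁅ξ, A.tlaForm p (Y.val p)⁆ = ⁅ξ, A.form p (Y.vec p)⁆ - ⁅ξ, Y.alg p⁆ := lie_sub _ _ _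
  rw [hbracket, hlie]
  refine hderiv.trans ((congrArg (· - dalg) (A.lieDeriv_form ξ Y.smooth_vec p)).trans ?_)
  abel

theorem lieDeriv_basicForm {C : Coeff EG G V} (hD : IsInfEquivariant C D) (ξ : LieAlg EG G)
    (Y : Fin q → TLASection EP EG G (Set.univ : Set P)) (p : P) :
    lieDeriv B C ξ (A.basicForm D) Y p = 0 := by
  set tlaVal : Fin q → LieAlg EG G := fun k => A.tlaForm p ((Y k).val p)
  have hderiv : dirDeriv (fun p' => A.basicForm D p' (fun k => (Y k).val p')) p
      (fundamental B p ξ) = ∑ k, D (Function.update tlaVal k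
        (A.tlaForm p (tlaBracket (fun p' => fundamental B p' ξ) (Y k).vec (fun _ => ξ)
          (Y k).alg p) - ⁅ξ, tlaVal k⁆)) :=
    (modelDeriv_alternating_comp (E := EP) (F := EG) D (fun k =>
      (contMDiffOn_univ.1 (A.contMDiffOn_tlaForm isOpen_univ (Y k))).mdifferentiableAt
        (by simp)) _).trans (Finset.sum_congr rfl fun k _ =>
          congrArg (fun w => D (Function.update tlaVal k w)) (A.lieDeriv_tlaForm ξ (Y k) p))
  have hbracket (k : Fin q) (w : TLAFiber EP EG G p) :
      A.basicForm D p (Function.update (fun j => (Y j).val p) k w) =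
        D (Function.update tlaVal k (A.tlaForm p w)) :=
    congrArg D (funext fun j => Function.apply_update (fun _ w => A.tlaForm p w) _ k w j)
  simp only [lieDeriv, hderiv, hbracket, D.map_update_sub, Finset.sum_sub_distrib, hD ξ tlaVal]
  rw [basicForm_apply]
  abel

theorem isBasic_basicForm {C : Coeff EG G V} (hD : IsInfEquivariant C D) :
    IsBasic B C (A.basicForm D) :=
  ⟨A.smoothOn_basicForm D, A.isHorizontal_basicForm D, A.lieDeriv_basicForm hD⟩

end Connection

end ConnectionForms

section LocalConnectionForms

variable {EM EP EG : Type*}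
  [NormedAddCommGroup EM] [NormedSpace ℝ EM] [FiniteDimensional ℝ EM]
  [NormedAddCommGroup EP] [NormedSpace ℝ EP]
  [NormedAddCommGroup EG] [NormedSpace ℝ EG] [FiniteDimensional ℝ EG]
  {M P G : Type*} [TopologicalSpace M] [ChartedSpace EM M] [IsManifold 𝓘(ℝ, EM) ∞ M] [T2Space M]
  [TopologicalSpace P] [ChartedSpace EP P] [IsManifold 𝓘(ℝ, EP) ∞ P]
  [TopologicalSpace G] [ChartedSpace EG G] [Group G] [LieGroup 𝓘(ℝ, EG) ∞ G]
  {V : Type*} [NormedAddCommGroup V] [NormedSpace ℝ V]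
  {B : PrincipalBundle EM EP EG M P G} (A : Connection B)
  {q : ℕ} {D : LieAlg EG G [⋀^Fin q]→L[ℝ] V}

lemma Connection.loc_atiyahForm {C : Coeff EG G V} (hD : IsEquivariant C D) (φ : B.Triv)
    (Y : Fin q → TLASection EM EG G φ.baseSet) (x : φ.baseSet) :
    (A.atiyahForm hD).loc φ Y x =
      D (fun k => (A.lieForm.loc φ (fun _ => Y k) x : LieAlg EG G)) := by
  obtain ⟨X, hX⟩ := φ.exists_invariantField_eventually_eq_S Y x.2
  have hlieForm (k : Fin q) : A.lieForm.loc φ (fun _ => Y k) x =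
      A.form (φ.sec x) ((X k).val (φ.sec x)) :=
    A.lieForm.loc_eq_val (X := fun _ => X k) (hX.mono fun y hy _ => hy k)
  rw [(A.atiyahForm hD).loc_eq_val hX, atiyahForm_val]
  exact congrArg D (funext fun k => (hlieForm k).symm)

end LocalConnectionForms

open Matrix in
lemma sum_det_updateRow_mul {n R : Type*} [Fintype n] [DecidableEq n] [CommRing R]
    (A B : Matrix n n R) : ∑ k, (A.updateRow k ((A * B) k)).det = B.trace * A.det := by
  have hrow (k : n) : (A.updateRow k ((A * B) k)).det = (A * B * A.adjugate) k k := by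
    rw [← cramer_transpose_apply, cramer_eq_adjugate_mulVec, ← adjugate_transpose, mulVec_transpose]
    rfl
  calc ∑ k, (A.updateRow k ((A * B) k)).det = (A * B * A.adjugate).trace :=
        Finset.sum_congr rfl fun k _ => hrow k
    _ = (B * (A.det • 1)).trace := by
        rw [Matrix.mul_assoc, trace_mul_comm, Matrix.mul_assoc, adjugate_mul]
    _ = B.trace * A.det := by
        rw [Matrix.mul_smul, Matrix.mul_one, trace_smul, smul_eq_mul, mul_comm]

section Wedge

variable {W : Type*} [AddCommGroup W] [Module ℝ W] {n : ℕ} (b : Module.Basis (Fin n) ℝ W)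

lemma wedge_apply (α : Fin n → W →ₗ[ℝ] ℝ) (v : Fin n → W) :
    wedge α v = (Matrix.of fun j i => α i (v j)).det :=
  rfl

lemma sum_wedge_coord_update (f : W →ₗ[ℝ] W) (v : Fin n → W) :
    ∑ k, wedge b.coord (Function.update v k (f (v k))) =
      LinearMap.trace ℝ W f * wedge b.coord v := by
  set A : Matrix (Fin n) (Fin n) ℝ := Matrix.of fun j i => b.coord i (v j)
  have hmul (k : Fin n) : (A * (LinearMap.toMatrix b b f).transpose) k =
      fun i => b.coord i (f (v k)) := by
    funext i
    rw [Matrix.mul_apply, Module.Basis.coord_apply, ← LinearMap.toMatrix_mulVec_repr b b f (v k)]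
    exact Finset.sum_congr rfl fun j _ => mul_comm _ _
  have hupdate (k : Fin n) : wedge b.coord (Function.update v k (f (v k))) =
      (A.updateRow k ((A * (LinearMap.toMatrix b b f).transpose) k)).det := by
    rw [hmul]
    exact congrArg Matrix.det (funext fun j =>
      Function.apply_update (fun _ w i => b.coord i w) v k (f (v k)) j)
  rw [Finset.sum_congr rfl fun k _ => hupdate k, sum_det_updateRow_mul, Matrix.trace_transpose,
    ← LinearMap.trace_eq_matrix_trace, wedge_apply]

end Wedge

lemma continuous_wedge {W : Type*} [NormedAddCommGroup W] [NormedSpace ℝ W] [FiniteDimensional ℝ W]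
    {n : ℕ} (α : Fin n → W →ₗ[ℝ] ℝ) : Continuous (wedge α) :=
  Continuous.matrix_det (continuous_matrix fun j i =>
    (LinearMap.continuous_of_finiteDimensional (α i)).comp (continuous_apply j))

section Volume

variable {EG : Type*} [NormedAddCommGroup EG] [NormedSpace ℝ EG] [FiniteDimensional ℝ EG]
  {G : Type*} [TopologicalSpace G] [ChartedSpace EG G] [Group G] [LieGroup 𝓘(ℝ, EG) ∞ G]
  (𝕜 : Type*) [RCLike 𝕜] {n : ℕ} (b : Module.Basis (Fin n) ℝ (LieAlg EG G))

/-- The alternating form `(-1)^n √|k| θ^1 ∧ … ∧ θ^n` on `𝔤`, for the basis `(θ^a)` dual to `b`. The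
sign makes its value on the components of `-θ` equal to `√|k| θ^1 ∧ … ∧ θ^n`. -/
def lieVolume : LieAlg EG G [⋀^Fin n]→L[ℝ] 𝕜 where
  toAlternatingMap := (RCLike.ofRealCLM (K := 𝕜)).toLinearMap.compAlternatingMap
    (((-1 : ℝ) ^ n * sqrtKilling b) • wedge b.coord)
  cont := RCLike.continuous_ofReal.comp
    (continuous_const.mul (continuous_wedge (W := EG) fun i => b.coord i))

lemma lieVolume_apply (v : Fin n → LieAlg EG G) :
    lieVolume 𝕜 b v = (((-1) ^ n * sqrtKilling b * wedge b.coord v : ℝ) : 𝕜) :=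
  rfl

lemma isInfEquivariant_lieVolume
    (htrace : ∀ ξ : LieAlg EG G, LinearMap.trace ℝ _ (LieAlgebra.ad ℝ (LieAlg EG G) ξ) = 0) :
    IsInfEquivariant (scalar EG G 𝕜) (lieVolume 𝕜 b) := fun ξ v => by
  have hsum := sum_wedge_coord_update b (LieAlgebra.ad ℝ (LieAlg EG G) ξ : LieAlg EG G →ₗ[ℝ] _) v
  rw [htrace, zero_mul] at hsum
  change ∑ k, lieVolume 𝕜 b (Function.update v k (LieAlgebra.ad ℝ (LieAlg EG G) ξ (v k))) = 0
  simp only [lieVolume_apply]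
  rw [← RCLike.ofReal_sum, ← Finset.mul_sum, hsum, mul_zero, RCLike.ofReal_zero]

variable {EM EP : Type*}
  [NormedAddCommGroup EM] [NormedSpace ℝ EM] [NormedAddCommGroup EP] [NormedSpace ℝ EP]
  {M P : Type*} [TopologicalSpace M] [ChartedSpace EM M]
  [TopologicalSpace P] [ChartedSpace EP P] [IsManifold 𝓘(ℝ, EP) ∞ P]
  {B : PrincipalBundle EM EP EG M P G} (A : Connection B)

lemma volumeTLAForm_eq_basicForm : volumeTLAForm 𝕜 b A = A.basicForm (lieVolume 𝕜 b) := by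
  refine funext fun p => AlternatingMap.ext fun Y => ?_
  refine congrArg (fun d : ℝ => (((-1) ^ n * sqrtKilling b * d : ℝ) : 𝕜)) ?_
  exact congrArg Matrix.det (Matrix.ext fun k i =>
    (map_sub (b.coord i) (A.form p (Y k).1) (Y k).2).symm)

variable {𝕜 b A} [IsManifold 𝓘(ℝ, EM) ∞ M]

lemma isVolumeForm_iff {α : AtiyahForm B (scalar EG G 𝕜) n} :
    IsVolumeForm b A α ↔ ∀ (φ : B.Triv) Y x, α.loc φ Y x =
      lieVolume 𝕜 b (fun k => (A.lieForm.loc φ (fun _ => Y k) x : LieAlg EG G)) := by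
  have hdet (v : Fin n → LieAlg EG G) : lieVolume 𝕜 b v = (((-1) ^ n * sqrtKilling b *
      (Matrix.of fun i j => b.coord i (v j)).det : ℝ) : 𝕜) := by
    rw [lieVolume_apply, wedge_apply, ← Matrix.det_transpose]
    rfl
  exact forall_congr' fun φ => forall₂_congr fun Y x =>
    ⟨fun h => h.trans (hdet _).symm, fun h => h.trans (hdet _)⟩

variable [FiniteDimensional ℝ EM] [T2Space M]

lemma isVolumeForm_atiyahForm (hD : IsEquivariant (scalar EG G 𝕜) (lieVolume 𝕜 b)) :
    IsVolumeForm b A (A.atiyahForm hD) :=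
  isVolumeForm_iff.2 (A.loc_atiyahForm hD)

lemma IsVolumeForm.unique {α α' : AtiyahForm B (scalar EG G 𝕜) n} (h : IsVolumeForm b A α)
    (h' : IsVolumeForm b A α') : α = α' :=
  AtiyahForm.ext_of_loc_eq fun φ => funext fun Y => funext fun x => (h φ Y x).trans (h' φ Y x).symm

end Volume

end Atiyah

end

theorem mainTheorem10_general
    {EM EP EG : Type*}
    [NormedAddCommGroup EM] [NormedSpace ℝ EM] [FiniteDimensional ℝ EM]
    [NormedAddCommGroup EP] [NormedSpace ℝ EP] [FiniteDimensional ℝ EP]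
    [NormedAddCommGroup EG] [NormedSpace ℝ EG] [FiniteDimensional ℝ EG]
    {M P G : Type*}
    [TopologicalSpace M] [ChartedSpace EM M] [IsManifold 𝓘(ℝ, EM) ∞ M] [T2Space M]
    [TopologicalSpace P] [ChartedSpace EP P] [IsManifold 𝓘(ℝ, EP) ∞ P]
    [TopologicalSpace G] [ChartedSpace EG G] [Group G] [LieGroup 𝓘(ℝ, EG) ∞ G]
    [PreconnectedSpace G]
    (hunimodular : ∀ ξ : Atiyah.LieAlg EG G,
      LinearMap.trace ℝ _ (LieAlgebra.ad ℝ (Atiyah.LieAlg EG G) ξ) = 0)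
    (B : Atiyah.PrincipalBundle EM EP EG M P G) :
    (∀ (V : Type*) [NormedAddCommGroup V] [NormedSpace ℝ V] (C : Atiyah.Coeff EG G V) (q : ℕ)
      (α : Atiyah.AtiyahForm B C q) (β : Atiyah.TLAForm EP P EG G V q),
      β.SmoothOn Set.univ → Atiyah.Corresponds β α →
      ∀ φ : B.Triv, (β.pullback φ).SmoothOn φ.baseSet ∧
        α.loc φ = (β.pullback φ).onSections) ∧
    (∀ (𝕜 : Type*) [RCLike 𝕜] (n : ℕ) (b : Module.Basis (Fin n) ℝ (Atiyah.LieAlg EG G))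
      (A : Atiyah.Connection B),
      (∃! α : Atiyah.AtiyahForm B (Atiyah.scalar EG G 𝕜) n, Atiyah.IsVolumeForm b A α) ∧
      Atiyah.IsBasic B (Atiyah.scalar EG G 𝕜) (Atiyah.volumeTLAForm 𝕜 b A) ∧
      ∀ α : Atiyah.AtiyahForm B (Atiyah.scalar EG G 𝕜) n, Atiyah.IsVolumeForm b A α →
        ∀ β : Atiyah.TLAForm EP P EG G 𝕜 n,
          Atiyah.Corresponds β α ↔ β = Atiyah.volumeTLAForm 𝕜 b A) := by
  refine ⟨fun V _ _ C q α β hβ h φ => ⟨φ.smoothOn_pullback hβ, h.loc_eq_onSections_pullback φ⟩,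
    fun 𝕜 _ n b A => ?_⟩
  have hinf := Atiyah.isInfEquivariant_lieVolume 𝕜 b hunimodular
  have hvolume := Atiyah.isVolumeForm_atiyahForm (A := A) hinf.isEquivariant_scalar
  have hcorresponds := A.corresponds_basicForm hinf.isEquivariant_scalar
  rw [Atiyah.volumeTLAForm_eq_basicForm]
  refine ⟨⟨_, hvolume, fun α hα => hα.unique hvolume⟩, A.isBasic_basicForm hinf,
    fun α hα β => ?_⟩
  obtain rfl := hα.unique hvolume
  exact ⟨fun h => h.unique hcorresponds, fun h => h ▸ hcorresponds⟩

theorem mainTheorem10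
    {EM EP EG : Type*}
    [NormedAddCommGroup EM] [NormedSpace ℝ EM] [FiniteDimensional ℝ EM]
    [NormedAddCommGroup EP] [NormedSpace ℝ EP] [FiniteDimensional ℝ EP]
    [NormedAddCommGroup EG] [NormedSpace ℝ EG] [FiniteDimensional ℝ EG]
    {M P G : Type*}
    [TopologicalSpace M] [ChartedSpace EM M] [IsManifold 𝓘(ℝ, EM) ∞ M]
    [T2Space M] [SecondCountableTopology M]
    [TopologicalSpace P] [ChartedSpace EP P] [IsManifold 𝓘(ℝ, EP) ∞ P]
    [T2Space P] [SecondCountableTopology P]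
    [TopologicalSpace G] [ChartedSpace EG G] [Group G] [LieGroup 𝓘(ℝ, EG) ∞ G]
    [T2Space G] [SecondCountableTopology G] [SimplyConnectedSpace G]
    [LieAlgebra.IsSemisimple ℝ (Atiyah.LieAlg EG G)]
    (hunimodular : ∀ ξ : Atiyah.LieAlg EG G,
      LinearMap.trace ℝ _ (LieAlgebra.ad ℝ (Atiyah.LieAlg EG G) ξ) = 0)
    (B : Atiyah.PrincipalBundle EM EP EG M P G) :
    -- forms with values in the kernel: local trivializations are pull-backs of the basic form
    (∀ (q : ℕ) (α : Atiyah.AtiyahForm B (Atiyah.adjoint EG G) q)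
      (β : Atiyah.TLAForm EP P EG G EG q),
      Atiyah.IsBasic B (Atiyah.adjoint EG G) β → Atiyah.Corresponds β α →
      ∀ φ : B.Triv, (β.pullback φ).SmoothOn φ.baseSet ∧
        α.loc φ = (β.pullback φ).onSections) ∧
    -- the same with complex coefficients
    (∀ (q : ℕ) (α : Atiyah.AtiyahForm B (Atiyah.adjointC EG G) q)
      (β : Atiyah.TLAForm EP P EG G (EG × EG) q),
      Atiyah.IsBasic B (Atiyah.adjointC EG G) β → Atiyah.Corresponds β α →
      ∀ φ : B.Triv, (β.pullback φ).SmoothOn φ.baseSet ∧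
        α.loc φ = (β.pullback φ).onSections) ∧
    -- the volume form exists, is unique, and has the stated corresponding basic form
    (∀ (𝕜 : Type) [RCLike 𝕜] (n : ℕ) (b : Module.Basis (Fin n) ℝ (Atiyah.LieAlg EG G))
      (A : Atiyah.Connection B),
      (∃! α : Atiyah.AtiyahForm B (Atiyah.scalar EG G 𝕜) n, Atiyah.IsVolumeForm b A α) ∧
      ∀ α : Atiyah.AtiyahForm B (Atiyah.scalar EG G 𝕜) n, Atiyah.IsVolumeForm b A α →
        Atiyah.IsBasic B (Atiyah.scalar EG G 𝕜) (Atiyah.volumeTLAForm 𝕜 b A) ∧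
        Atiyah.Corresponds (Atiyah.volumeTLAForm 𝕜 b A) α ∧
        ∀ β : Atiyah.TLAForm EP P EG G 𝕜 n,
          Atiyah.IsBasic B (Atiyah.scalar EG G 𝕜) β → Atiyah.Corresponds β α →
          β = Atiyah.volumeTLAForm 𝕜 b A) := by
  obtain ⟨hpullback, hvolume⟩ := mainTheorem10_general hunimodular B
  exact ⟨fun q α β hβ => hpullback EG _ q α β hβ.1,
    fun q α β hβ => hpullback (EG × EG) _ q α β hβ.1, fun 𝕜 _ n b A => ⟨(hvolume 𝕜 n b A).1,
      fun α hα => ⟨(hvolume 𝕜 n b A).2.1, ((hvolume 𝕜 n b A).2.2 α hα _).2 rfl,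
        fun β _ => ((hvolume 𝕜 n b A).2.2 α hα β).1⟩⟩⟩
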